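/- Power series are in the variables $x_1,x_2,\dots$ over $\mathbb{Q}$. A composition is a finite (possibly empty) sequence $\alpha=(\alpha_1,\dots,\alpha_k)$ of positive integers; $\ell(\alpha)=k$ and $|\alpha|=\sum_i\alpha_i$. Its diagram has $\alpha_i$ left-justified cells in row $i$, row $1$ being the bottom row. Write $\beta\subseteq\alpha$ if $\ell(\beta)\le\ell(\alpha)$ and $\beta_j\le\alpha_j$ for $1\le j\le\ell(\beta)$; then $\alpha/\beta$ is the set of cells of the diagram of $\alpha$ that are not in the diagram of $\beta$. For a filling $T$ of a set of cells with positive integers, $x^T=\prod_i x_i^{\#\{\text{cells with entry } i\}}$. Let $\mathrm{NSym}=\mathbb{Q}\langle \mathbf{e}_1,\mathbf{e}_2,\dots\rangle$ be the algebra of noncommutative symmetric functions, $\mathbf{h}_n=\sum_{(\alpha_1,\dots,\alpha_m)\vDash n}(-1)^{n-m}\mathbf{e}_{\alpha_1}\cdots\mathbf{e}_{\alpha_m}$ and $\mathbf{h}_\gamma=\mathbf{h}_{\gamma_1}\cdots\mathbf{h}_{\gamma_k}$. Let $M_\gamma=\sum_{i_1<\cdots<i_k}x_{i_1}^{\gamma_1}\cdots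 x_{i_k}^{\gamma_k}$ be the monomial basis of the space $\mathrm{QSym}$ of quasisymmetric functions, and let $\langle\cdot,\cdot\rangle:\mathrm{NSym}\times\mathrm{QSym}\to\mathbb{Q}$ be the bilinear pairing with $\langle\mathbf{h}_\alpha,M_\beta\rangle=\delta_{\alpha\beta}$. An immaculate tableau (respectively, a row-strict immaculate tableau) of shape $\alpha$ is a filling of the diagram of $\alpha$ with positive integers whose first column is strictly (respectively, weakly) increasing from bottom to top and whose rows are weakly (respectively, strictly) increasing from left to right. Let $\mathfrak{S}^*_\alpha=\sum_D x^D$, over all immaculate tableaux $D$ of shape $\alpha$, and $\mathcal{R}\mathfrak{S}^*_\alpha=\sum_U x^U$, over all row-strict immaculate tableaux $U$ of shape $\alpha$. Let $\mathfrak{S}_\beta,\mathcal{R}\mathfrak{S}_\beta\in\mathrm{NSym}$ be the elements determined by $\langle\mathfrak{S}_\beta,\mathfrak{S}^*_\alpha\rangle=\delta_{\alpha\beta}$ and $\langle\mathcal{R}\mathfrak{S}_\beta,\mathcal{R}\mathfrak{S}^*_\alpha\rangle=\delta_{\alpha\beta}$ for all compositions $\alpha$. For $\beta\subseteq\alpha$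 put $$\mathfrak{S}^*_{\alpha/\beta}=\sum_\gamma\langle\mathfrak{S}_\beta\mathbf{h}_\gamma,\mathfrak{S}^*_\alpha\rangle M_\gamma,\qquad \mathcal{R}\mathfrak{S}^*_{\alpha/\beta}=\sum_\gamma\langle\mathcal{R}\mathfrak{S}_\beta\mathbf{h}_\gamma,\mathcal{R}\mathfrak{S}^*_\alpha\rangle M_\gamma,$$ where $\gamma$ runs over all compositions (only finitely many terms are nonzero). A filling of $\alpha/\beta$ with positive integers is a skew immaculate tableau (respectively, a skew row-strict immaculate tableau) if its entries in the first column of $\alpha$ (if any such cells remain in $\alpha/\beta$) are strictly (respectively, weakly) increasing from bottom to top and its rows are weakly (respectively, strictly) increasing from left to right. **Theorem.** Let $\alpha$ and $\beta$ be compositions with $\beta\subseteq\alpha$. The elements $\mathfrak{S}_\beta$ and $\mathcal{R}\mathfrak{S}_\beta$ exist and are unique, and $$\mathfrak{S}^*_{\alpha/\beta}=\sum_T x^T,$$ where the sum is over all skew immaculate tableaux $T$ of shape $\alpha/\beta$, and $$\mathcal{R}\mathfrak{S}^*_{\alpha/\beta}=\sum_T x^T,$$ where the sum is over all skew row-strict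 immaculate tableaux $T$ of shape $\alpha/\beta$. -/

import Mathlib

section Aux

open Finset hiding mem_antidiagonal
open Finset.HasAntidiagonal

variable {A : Type*} [Ring A]

theorem signedCompositionSum_succ (a : ℕ → A) (n : ℕ) :
    ∑ c : Composition (n + 1), (-1 : A) ^ (n + 1 - c.length) * (c.blocks.map a).prod =
      ∑ p ∈ antidiagonal n, (-1 : A) ^ p.1 * a (p.1 + 1) *
        ∑ c : Composition p.2, (-1 : A) ^ (p.2 - c.length) * (c.blocks.map a).prod := by
  simp_rw [Finset.mul_sum]
  rw [Finset.sum_sigma']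
  symm
  refine Finset.sum_bij (fun x hx => (⟨(x.1.1 + 1) :: x.2.blocks, ?_, ?_⟩ : Composition (n+1))) ?_ ?_ ?_ ?_
  · intro i hi
    rcases List.mem_cons.1 hi with rfl | h
    · omega
    · exact x.2.blocks_pos h
  · have := mem_antidiagonal.1 (mem_sigma.1 hx).1
    simp [x.2.blocks_sum]; omega
  · intros; simp
  · rintro ⟨⟨p, q⟩, c⟩ h ⟨⟨p', q'⟩, c'⟩ h' he
    have h1 := mem_antidiagonal.1 (mem_sigma.1 h).1
    have h2 := mem_antidiagonal.1 (mem_sigma.1 h').1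
    simp only [Composition.mk.injEq, List.cons.injEq] at he h1 h2
    obtain rfl : p = p' := by omega
    obtain rfl : q = q' := by omega
    obtain rfl : c = c' := Composition.ext he.2
    rfl
  · rintro ⟨bl, hp, hs⟩ -
    cases bl with
    | nil => simp at hs
    | cons k t =>
      have hk : 0 < k := hp (by simp)
      simp only [List.sum_cons] at hs
      refine ⟨⟨(k - 1, t.sum), ⟨t, fun h => hp (by simp [h]), rfl⟩⟩, ?_, ?_⟩
      · simp only [mem_sigma, mem_antidiagonal, mem_univ, and_true]; omega
      · have e : k - 1 + 1 = k := by omega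
        simp [e]
  · rintro ⟨⟨p, q⟩, c⟩ h
    have h1 := mem_antidiagonal.1 (mem_sigma.1 h).1
    have hl := c.length_le
    simp only at h1 hl
    have e : n + 1 - (c.length + 1) = p + (q - c.length) := by omega
    simp only [Composition.length, List.length_cons, List.map_cons, List.prod_cons] at e ⊢
    rw [e, pow_add, ← mul_assoc, ← mul_assoc, mul_assoc ((-1 : A) ^ p), mul_assoc ((-1 : A) ^ p),
      ((Commute.neg_one_right (a (p+1))).pow_right _).eq]
    simp only [mul_assoc]


theorem signedCompositionSum_zero (a : ℕ → A) :
    ∑ c : Composition 0, (-1 : A) ^ (0 - c.length) * (c.blocks.map a).prod = 1 := by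
  have h : ∀ c : Composition 0, (-1 : A) ^ (0 - c.length) * (c.blocks.map a).prod = 1 := by
    intro c
    have : c.blocks = [] := c.blocks_eq_nil.2 rfl
    simp [this]
  rw [sum_congr rfl fun c _ => h c]
  simp [composition_card]

/-- `A(-t) B(t) = 1` -/
theorem signedCompositionSum_mk_mul (a : ℕ → A) (ha : a 0 = 1) :
    (PowerSeries.mk fun n => (-1 : A) ^ n * a n) *
      (PowerSeries.mk fun n => ∑ c : Composition n, (-1 : A) ^ (n - c.length) *
        (c.blocks.map a).prod) = 1 := by
  ext n
  rw [PowerSeries.coeff_mul, PowerSeries.coeff_one]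
  simp only [PowerSeries.coeff_mk]
  cases n with
  | zero => 
    rw [Nat.antidiagonal_zero, sum_singleton, signedCompositionSum_zero, ha]; simp
  | succ n =>
    rw [Finset.Nat.antidiagonal_succ, sum_cons, sum_map, signedCompositionSum_succ]
    simp [ha, pow_succ, Finset.sum_neg_distrib]
    exact add_neg_cancel _

theorem signedCompositionSum_twice (a : ℕ → A) (ha : a 0 = 1) (n : ℕ) :
    ∑ c : Composition n, (-1 : A) ^ (n - c.length) * (c.blocks.map fun m =>
      ∑ d : Composition m, (-1 : A) ^ (m - d.length) * (d.blocks.map a).prod).prod = a n := by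
  set b : ℕ → A := fun m => ∑ d : Composition m, (-1 : A) ^ (m - d.length) * (d.blocks.map a).prod
    with hb
  have h1 := signedCompositionSum_mk_mul a ha
  have h2 := signedCompositionSum_mk_mul b (signedCompositionSum_zero a)
  set c : ℕ → A := fun n => ∑ c : Composition n, (-1 : A) ^ (n - c.length) * (c.blocks.map b).prod
  -- replacing `t` by `-t` in the second identity
  have h3 : PowerSeries.mk b * (PowerSeries.mk fun n => (-1 : A) ^ n * c n) = 1 := by
    ext n
    have h := congrArg (fun z => (-1 : A) ^ n * PowerSeries.coeff n z) h2
    simp only [PowerSeries.coeff_mul, PowerSeries.coeff_one, PowerSeries.coeff_mk,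
      Finset.mul_sum] at h ⊢
    convert h using 1
    · refine sum_congr rfl fun p hp => ?_
      have h6 : ∀ x : A, (-1 : A) ^ p.1 * ((-1 : A) ^ p.1 * x) = x := by
        intro x
        rw [← mul_assoc, ← pow_add, Even.neg_one_pow ⟨p.1, rfl⟩, one_mul]
      rw [← mem_antidiagonal.1 hp, add_comm, pow_add, mul_assoc ((-1 : A) ^ p.2),
        mul_assoc ((-1 : A) ^ p.1), h6, ← mul_assoc, ← mul_assoc,
        ((Commute.neg_one_right (b p.1)).pow_right p.2).eq]
    · split_ifs with h0 <;> simp [h0]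
  have h4 := left_inv_eq_right_inv h1 h3
  have h5 := congrArg (PowerSeries.coeff n) h4
  simp only [PowerSeries.coeff_mk] at h5
  have h6 : ∀ x : A, (-1 : A) ^ n * ((-1 : A) ^ n * x) = x := by
    intro x
    rw [← mul_assoc, ← pow_add, Even.neg_one_pow ⟨n, rfl⟩, one_mul]
  rw [← h6 (a n), h5, h6]

end Aux

/-- A composition: a finite sequence of positive integers (the empty one included). -/
abbrev Comp := List ℕ+

/-- `|α|`, the sum of the parts. -/
def Comp.size (α : Comp) : ℕ := (α.map fun a : ℕ+ => (a : ℕ)).sum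

/-- The length of row `i` of the diagram of `α` (rows are numbered from `0`, from bottom to top);
it is `0` beyond the last part. -/
def Comp.part (α : Comp) (i : ℕ) : ℕ := (α.map fun a : ℕ+ => (a : ℕ)).getD i 0

/-- `β ⊆ α`: no more parts, and every part of `β` is at most the corresponding part of `α`. -/
def Comp.Contained (β α : Comp) : Prop :=
  β.length ≤ α.length ∧ ∀ j < β.length, Comp.part β j ≤ Comp.part α j

/-! ### Noncommutative symmetric functions -/

/-- `NSym = ℚ⟨e₁, e₂, …⟩`, the free associative algebra. -/
abbrev NSym := FreeAlgebra ℚ ℕ+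

/-- The elementary noncommutative symmetric function `e_n`, with `e_0 = 1`. -/
noncomputable def nce (n : ℕ) : NSym := if h : 0 < n then FreeAlgebra.ι ℚ (n.toPNat h) else 1

/-- The complete homogeneous function
`h_n = ∑_{(α₁,…,α_m) ⊨ n} (-1)^{n-m} e_{α₁} ⋯ e_{α_m}`; here `h_0 = 1`. -/
noncomputable def nch (n : ℕ) : NSym :=
  ∑ c : Composition n, (-1 : NSym) ^ (n - c.length) * (c.blocks.map nce).prod

/-- `h_γ = h_{γ₁} ⋯ h_{γ_k}`. -/
noncomputable def nchComp (γ : Comp) : NSym := (γ.map fun a : ℕ+ => nch a).prod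

theorem nch_zero : nch 0 = 1 := signedCompositionSum_zero nce

theorem nce_pos (a : ℕ+) : nce a = FreeAlgebra.ι ℚ a := by
  rw [nce, dif_pos a.pos]
  rfl

theorem nchComp_append (γ δ : Comp) : nchComp (γ ++ δ) = nchComp γ * nchComp δ := by
  simp [nchComp]

/-- The endomorphism of `NSym` with `e_n ↦ h_n`. -/
noncomputable def nsymPsi : NSym →ₐ[ℚ] NSym := FreeAlgebra.lift ℚ fun a : ℕ+ => nch a

theorem nsymPsi_nce (n : ℕ) : nsymPsi (nce n) = nch n := by
  rcases Nat.eq_zero_or_pos n with rfl | h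
  · simp [nch_zero, nce]
  · rw [show nce n = FreeAlgebra.ι ℚ (n.toPNat h) from dif_pos h, nsymPsi, FreeAlgebra.lift_ι_apply]
    rfl

theorem nsymPsi_nch (n : ℕ) : nsymPsi (nch n) = nce n := by
  rw [← signedCompositionSum_twice nce (by simp [nce]) n, nch, map_sum]
  refine Finset.sum_congr rfl fun c _ => ?_
  rw [map_mul, map_pow, map_neg, map_one, map_list_prod, List.map_map]
  congr 3
  funext m
  exact nsymPsi_nce m

theorem nsymPsi_comp_self : nsymPsi.comp nsymPsi = AlgHom.id ℚ NSym := by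
  ext a
  have h := nsymPsi_nch a
  rw [← nsymPsi_nce, nce_pos] at h
  simpa using h

/-- The family `h_γ` is a basis of `NSym`. -/
noncomputable def nchBasis : Module.Basis Comp ℚ NSym :=
  ((FreeAlgebra.basisFreeMonoid ℚ ℕ+).map
    (AlgEquiv.ofAlgHom nsymPsi nsymPsi nsymPsi_comp_self nsymPsi_comp_self).toLinearEquiv).reindex
      FreeMonoid.toList

theorem nchBasis_apply (γ : Comp) : nchBasis γ = nchComp γ := by
  have h : (FreeAlgebra.basisFreeMonoid ℚ ℕ+) (FreeMonoid.ofList γ) =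
      (γ.map fun a : ℕ+ => nce a).prod := by
    change (MonoidAlgebra.lift ℚ _ _ (FreeMonoid.lift (FreeAlgebra.ι ℚ)))
      (MonoidAlgebra.single (FreeMonoid.ofList γ) (1 : ℚ)) = _
    rw [MonoidAlgebra.lift_single, one_smul, FreeMonoid.lift_apply, FreeMonoid.toList_ofList]
    congr 2
    funext a
    exact (nce_pos a).symm
  rw [nchBasis, Module.Basis.reindex_apply, Module.Basis.map_apply,
    show FreeMonoid.toList.symm γ = FreeMonoid.ofList γ from rfl, h]
  change nsymPsi _ = _
  rw [map_list_prod, List.map_map, nchComp]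
  congr 2
  funext a
  exact nsymPsi_nce a

/-! ### Quasisymmetric functions

Power series are over `ℚ`, in variables indexed by `ℕ`; the index `i` stands for `x_{i+1}`, so that
an entry `i` of a tableau stands for the positive integer `i + 1`. -/

/-- The generating function `∑_t x^{wt t}` of a family of monomials, of which only finitely many
are equal to any given one. -/
noncomputable def generatingFunction {ι : Type*} (wt : ι → (ℕ →₀ ℕ)) : MvPowerSeries ℕ ℚ :=
  fun m => (Nat.card {t : ι // wt t = m} : ℚ)

theorem coeff_generatingFunction {ι : Type*} (wt : ι → (ℕ →₀ ℕ)) (m : ℕ →₀ ℕ) :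
    MvPowerSeries.coeff m (generatingFunction wt) = (Nat.card {t : ι // wt t = m} : ℚ) := rfl

/-- The exponent of the monomial `x_{i₁}^{γ₁} ⋯ x_{i_k}^{γ_k}`. -/
noncomputable def Comp.exponent (γ : Comp) (i : Fin γ.length → ℕ) : ℕ →₀ ℕ :=
  ∑ t, Finsupp.single (i t) (γ.get t : ℕ)

/-- The space `QSym` of quasisymmetric functions: power series of bounded degree in which
`x_{i₁}^{γ₁} ⋯ x_{i_k}^{γ_k}` with `i₁ < ⋯ < i_k` has the same coefficient as
`x_1^{γ₁} ⋯ x_k^{γ_k}`. -/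
def QSym : Submodule ℚ (MvPowerSeries ℕ ℚ) where
  carrier := {f | (∃ N : ℕ, ∀ m, MvPowerSeries.coeff m f ≠ 0 → m.degree ≤ N) ∧
    ∀ (γ : Comp) (i : Fin γ.length → ℕ), StrictMono i →
      MvPowerSeries.coeff (Comp.exponent γ i) f =
        MvPowerSeries.coeff (Comp.exponent γ fun t => (t : ℕ)) f}
  zero_mem' := ⟨⟨0, fun m h => (h (by simp)).elim⟩, fun γ i _ => by simp⟩
  add_mem' := by
    rintro f g ⟨⟨N, hN⟩, hf⟩ ⟨⟨M, hM⟩, hg⟩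
    refine ⟨⟨max N M, fun m h => ?_⟩, fun γ i hi => ?_⟩
    · by_cases h0 : MvPowerSeries.coeff m f = 0
      · exact le_max_of_le_right (hM m fun h1 => h (by simp [h0, h1]))
      · exact le_max_of_le_left (hN m h0)
    · simp [hf γ i hi, hg γ i hi]
  smul_mem' := by
    rintro r f ⟨⟨N, hN⟩, hf⟩
    refine ⟨⟨N, fun m h => hN m fun h0 => h (by simp [h0])⟩, fun γ i hi => ?_⟩
    simp [hf γ i hi]

/-- The pairing `NSym × QSym → ℚ`: `⟨h_γ, f⟩` is the coefficient of `x_1^{γ₁} ⋯ x_k^{γ_k}` in `f`,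
that is, the coefficient of `M_γ` in the monomial expansion of `f`. -/
noncomputable def pairing : NSym →ₗ[ℚ] QSym →ₗ[ℚ] ℚ :=
  nchBasis.constr ℚ fun γ =>
    (MvPowerSeries.coeff (R := ℚ) (Comp.exponent γ fun t => (t : ℕ))).comp QSym.subtype

theorem pairing_nchComp (γ : Comp) (f : QSym) :
    pairing (nchComp γ) f = MvPowerSeries.coeff (Comp.exponent γ fun t => (t : ℕ)) f.1 := by
  rw [← nchBasis_apply, pairing, Module.Basis.constr_basis]
  rfl

/-! ### Fillings -/

section Fillings

variable {C : Type*} [Fintype C]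

/-- The exponent of `∏_c x_{T c}^{w c}`. -/
noncomputable def fillingWeight (w : C → ℕ) (T : C → ℕ) : ℕ →₀ ℕ :=
  ∑ c, Finsupp.single (T c) (w c)

theorem support_fillingWeight {w : C → ℕ} (hw : ∀ c, 0 < w c) (T : C → ℕ) (n : ℕ) :
    n ∈ (fillingWeight w T).support ↔ ∃ c, T c = n := by
  rw [Finsupp.mem_support_iff, fillingWeight, Finsupp.finsetSum_apply, ne_eq,
    Finset.sum_eq_zero_iff]
  simp only [Finset.mem_univ, true_implies, Finsupp.single_apply, not_forall, ite_eq_right_iff]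
  constructor
  · rintro ⟨c, h, -⟩
    exact ⟨c, h⟩
  · rintro ⟨c, h⟩
    exact ⟨c, h, (hw c).ne'⟩

theorem degree_fillingWeight (w T : C → ℕ) : (fillingWeight w T).degree = ∑ c, w c := by
  simp [fillingWeight, map_sum]

/-- Only finitely many fillings have a given content. -/
theorem finite_fillingWeight {w : C → ℕ} (hw : ∀ c, 0 < w c) (P : (C → ℕ) → Prop) (m : ℕ →₀ ℕ) :
    Finite {T : {T : C → ℕ // P T} // fillingWeight w T.1 = m} := by
  refine Finite.of_injective
    (β := C → m.support) (fun T c => ⟨T.1.1 c, ?_⟩) fun T T' h => ?_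
  · have := (support_fillingWeight hw T.1.1 (T.1.1 c)).2 ⟨c, rfl⟩
    rwa [T.2] at this
  · apply Subtype.ext
    apply Subtype.ext
    funext c
    exact congrArg Subtype.val (congrFun h c)

/-- Replacing `i t` by `j t` in a filling. -/
theorem relabel_aux {w : C → ℕ} (hw : ∀ c, 0 < w c) {P : (C → ℕ) → Prop}
    (hP : ∀ T T' : C → ℕ, (∀ c d, T c ≤ T d ↔ T' c ≤ T' d) → P T → P T')
    (γ : Comp) (i j : Fin γ.length → ℕ) (hi : StrictMono i) (hj : StrictMono j)
    (T : C → ℕ) (hT : P T) (hm : fillingWeight w T = Comp.exponent γ i) :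
    P (Function.extend i j 0 ∘ T) ∧
      fillingWeight w (Function.extend i j 0 ∘ T) = Comp.exponent γ j ∧
      Function.extend j i 0 ∘ (Function.extend i j 0 ∘ T) = T := by
  have hr : ∀ c, ∃ t, i t = T c := by
    intro c
    have h := (support_fillingWeight hw T (T c)).2 ⟨c, rfl⟩
    rw [hm] at h
    exact (support_fillingWeight (w := fun t => (γ.get t : ℕ)) (fun t => (γ.get t).pos) i _).1 h
  choose s hs using hr
  have e : ∀ c, Function.extend i j 0 (T c) = j (s c) := by
    intro c
    rw [← hs c, hi.injective.extend_apply]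
  refine ⟨hP T _ (fun c d => ?_) hT, ?_, ?_⟩
  · simp only [Function.comp_apply, e, hj.le_iff_le]
    rw [← hs c, ← hs d, hi.le_iff_le]
  · have h := congrArg (Finsupp.mapDomain (Function.extend i j 0)) hm
    simpa [fillingWeight, Comp.exponent, Finsupp.mapDomain_finsetSum, Finsupp.mapDomain_single,
      hi.injective.extend_apply] using h
  · funext c
    simp only [Function.comp_apply, e, hj.injective.extend_apply, hs]

theorem generatingFunction_mem_QSym {w : C → ℕ} (hw : ∀ c, 0 < w c) {P : (C → ℕ) → Prop}
    (hP : ∀ T T' : C → ℕ, (∀ c d, T c ≤ T d ↔ T' c ≤ T' d) → P T → P T') :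
    generatingFunction (fun T : {T : C → ℕ // P T} => fillingWeight w T.1) ∈ QSym := by
  refine ⟨⟨∑ c, w c, fun m h => ?_⟩, fun γ i hi => ?_⟩
  · rw [coeff_generatingFunction] at h
    have : Nonempty {T : {T : C → ℕ // P T} // fillingWeight w T.1 = m} := by
      by_contra h0
      rw [not_nonempty_iff] at h0
      exact h (by simp)
    obtain ⟨T, rfl⟩ := this
    rw [degree_fillingWeight]
  · have hj : StrictMono fun t : Fin γ.length => (t : ℕ) := fun _ _ h => h
    rw [coeff_generatingFunction, coeff_generatingFunction]
    congr 1
    exact Nat.card_congr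
      { toFun := fun T => ⟨⟨_, (relabel_aux hw hP γ i _ hi hj T.1.1 T.1.2 T.2).1⟩,
          (relabel_aux hw hP γ i _ hi hj T.1.1 T.1.2 T.2).2.1⟩
        invFun := fun T => ⟨⟨_, (relabel_aux hw hP γ _ i hj hi T.1.1 T.1.2 T.2).1⟩,
          (relabel_aux hw hP γ _ i hj hi T.1.1 T.1.2 T.2).2.1⟩
        left_inv := fun T => Subtype.ext (Subtype.ext
          (relabel_aux hw hP γ i _ hi hj T.1.1 T.1.2 T.2).2.2)
        right_inv := fun T => Subtype.ext (Subtype.ext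
          (relabel_aux hw hP γ _ i hj hi T.1.1 T.1.2 T.2).2.2) }

end Fillings

/-- The monomial quasisymmetric function
`M_γ = ∑_{i₁ < ⋯ < i_k} x_{i₁}^{γ₁} ⋯ x_{i_k}^{γ_k}`. -/
noncomputable def monomialQSym (γ : Comp) : QSym :=
  ⟨generatingFunction fun i : {i : Fin γ.length → ℕ // StrictMono i} => Comp.exponent γ i.1,
    generatingFunction_mem_QSym (w := fun t => (γ.get t : ℕ)) (fun t => (γ.get t).pos)
      fun T T' h hT a b hab => by
        have := hT hab
        rw [← not_le, h, not_le] at this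
        exact this⟩

theorem exponent_inj {γ δ : Comp} {i : Fin δ.length → ℕ} (hi : StrictMono i)
    (h : Comp.exponent δ i = Comp.exponent γ fun t => (t : ℕ)) :
    δ = γ ∧ ∀ t, i t = t := by
  have hpos : ∀ (γ : Comp) (t : Fin γ.length), 0 < (γ.get t : ℕ) := fun γ t => (γ.get t).pos
  have hsupp : ∀ n, (∃ t, i t = n) ↔ n < γ.length := by
    intro n
    rw [← support_fillingWeight (hpos δ) i n]
    change n ∈ (Comp.exponent δ i).support ↔ _
    rw [h]
    refine (support_fillingWeight (hpos γ) (fun t => (t : ℕ)) n).trans ?_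
    exact ⟨fun ⟨t, ht⟩ => ht ▸ t.2, fun hn => ⟨⟨n, hn⟩, rfl⟩⟩
  have himg : Finset.univ.image i = Finset.range γ.length := by
    ext n; simp [hsupp]
  have hlen : δ.length = γ.length := by
    have := congrArg Finset.card himg
    rwa [Finset.card_image_of_injective _ hi.injective, Finset.card_univ, Fintype.card_fin,
      Finset.card_range] at this
  have hit : ∀ t, i t = t := by
    have h1 := Finset.orderEmbOfFin_unique (s := Finset.range γ.length) (k := δ.length)
      (by simp [hlen]) (f := i) (fun t => by simpa using (hsupp _).1 ⟨t, rfl⟩) hi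
    have h2 := Finset.orderEmbOfFin_unique (s := Finset.range γ.length) (k := δ.length)
      (by simp [hlen]) (f := fun t => (t : ℕ)) (fun t => by simp; omega) (fun _ _ h => h)
    intro t
    rw [h1, ← h2]
  refine ⟨?_, hit⟩
  have hcoef : ∀ (γ : Comp) (t : Fin γ.length),
      (Comp.exponent γ fun t => (t : ℕ)) (t : ℕ) = (γ.get t : ℕ) := by
    intro γ t
    simp [Comp.exponent, Finsupp.finsetSum_apply, Finsupp.single_apply, Fin.val_inj]
  have hi' : i = fun t : Fin δ.length => (t : ℕ) := funext hit
  refine List.ext_get hlen fun n h1 h2 => ?_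
  apply PNat.coe_injective
  rw [← hcoef δ ⟨n, h1⟩, ← hcoef γ ⟨n, h2⟩, ← h, hi']

/-- The property that characterises the pairing: `⟨h_γ, M_δ⟩ = 1` if `γ = δ`, and `0` otherwise. -/
theorem pairing_nchComp_monomialQSym (γ δ : Comp) :
    pairing (nchComp γ) (monomialQSym δ) = if γ = δ then 1 else 0 := by
  rw [pairing_nchComp]
  change ((Nat.card {i : {i : Fin δ.length → ℕ // StrictMono i} //
    Comp.exponent δ i.1 = Comp.exponent γ fun t => (t : ℕ)} : ℕ) : ℚ) = _
  split_ifs with h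
  · subst h
    have : Unique {i : {i : Fin γ.length → ℕ // StrictMono i} //
        Comp.exponent γ i.1 = Comp.exponent γ fun t => (t : ℕ)} :=
      { default := ⟨⟨fun t => (t : ℕ), fun _ _ h => h⟩, rfl⟩
        uniq := fun i => Subtype.ext (Subtype.ext (funext (exponent_inj i.1.2 i.2).2)) }
    simp
  · have : IsEmpty {i : {i : Fin δ.length → ℕ // StrictMono i} //
        Comp.exponent δ i.1 = Comp.exponent γ fun t => (t : ℕ)} :=
      ⟨fun i => h (exponent_inj i.1.2 i.2).1.symm⟩
    simp

/-! ### Immaculate tableaux -/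

/-- The diagram of `α`: `α_i` left-justified cells in row `i`. The cell `(i, j)` is the one in row
`i` (counted from the bottom) and column `j`, both counted from `0`. -/
def Comp.diagram (α : Comp) : Finset (ℕ × ℕ) :=
  (Finset.range α.length).biUnion fun i => {i} ×ˢ Finset.range (Comp.part α i)

/-- The cells of the skew shape `α/β`. -/
def Comp.skewDiagram (α β : Comp) : Finset (ℕ × ℕ) := Comp.diagram α \ Comp.diagram β

/-- A filling of a set of cells is immaculate if the entries in the first column increase strictly
from bottom to top and the rows increase weakly from left to right. -/
def IsImmaculate {D : Finset (ℕ × ℕ)} (T : D → ℕ) : Prop :=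
  (∀ c d : D, c.1.2 = 0 → d.1.2 = 0 → c.1.1 < d.1.1 → T c < T d) ∧
    ∀ c d : D, c.1.1 = d.1.1 → c.1.2 < d.1.2 → T c ≤ T d

/-- A filling of a set of cells is row-strict immaculate if the entries in the first column increase
weakly from bottom to top and the rows increase strictly from left to right. -/
def IsRowStrictImmaculate {D : Finset (ℕ × ℕ)} (T : D → ℕ) : Prop :=
  (∀ c d : D, c.1.2 = 0 → d.1.2 = 0 → c.1.1 < d.1.1 → T c ≤ T d) ∧
    ∀ c d : D, c.1.1 = d.1.1 → c.1.2 < d.1.2 → T c < T d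

/-- The immaculate tableaux with the cells `D`. -/
abbrev ImmaculateTableau (D : Finset (ℕ × ℕ)) := {T : D → ℕ // IsImmaculate T}

/-- The row-strict immaculate tableaux with the cells `D`. -/
abbrev RowStrictImmaculateTableau (D : Finset (ℕ × ℕ)) := {T : D → ℕ // IsRowStrictImmaculate T}

/-- The exponent of the content monomial `x^T`: every cell contributes `1` to the exponent of the
variable of its entry. -/
noncomputable def content {D : Finset (ℕ × ℕ)} (T : D → ℕ) : ℕ →₀ ℕ :=
  ∑ c, Finsupp.single (T c) 1

theorem finite_immaculateTableau_content (D : Finset (ℕ × ℕ)) (m : ℕ →₀ ℕ) :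
    Finite {T : ImmaculateTableau D // content T.1 = m} :=
  finite_fillingWeight (w := fun _ => 1) (fun _ => one_pos) _ m

theorem finite_rowStrictImmaculateTableau_content (D : Finset (ℕ × ℕ)) (m : ℕ →₀ ℕ) :
    Finite {T : RowStrictImmaculateTableau D // content T.1 = m} :=
  finite_fillingWeight (w := fun _ => 1) (fun _ => one_pos) _ m

/-- The dual immaculate function `𝔖*_α`. -/
noncomputable def dualImmaculate (α : Comp) : QSym :=
  ⟨generatingFunction fun T : ImmaculateTableau (Comp.diagram α) => content T.1,
    generatingFunction_mem_QSym (w := fun _ => 1) (fun _ => one_pos) fun T T' h hT =>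
      ⟨fun c d h1 h2 h3 => by
        have := hT.1 c d h1 h2 h3
        rwa [← not_le, h, not_le] at this,
      fun c d h1 h2 => (h c d).1 (hT.2 c d h1 h2)⟩⟩

/-- The row-strict dual immaculate function `ℛ𝔖*_α`. -/
noncomputable def rowStrictDualImmaculate (α : Comp) : QSym :=
  ⟨generatingFunction fun T : RowStrictImmaculateTableau (Comp.diagram α) => content T.1,
    generatingFunction_mem_QSym (w := fun _ => 1) (fun _ => one_pos) fun T T' h hT =>
      ⟨fun c d h1 h2 h3 => (h c d).1 (hT.1 c d h1 h2 h3),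
      fun c d h1 h2 => by
        have := hT.2 c d h1 h2
        rwa [← not_le, h, not_le] at this⟩⟩

/-! ### Dual elements and skew functions -/

/-- `g` has the defining property of the member indexed by `β` of the family in `NSym` dual to `f`. -/
def IsDualElement (f : Comp → QSym) (β : Comp) (g : NSym) : Prop :=
  ∀ α : Comp, pairing g (f α) = if β = α then 1 else 0

/-- The immaculate function `𝔖_β`, determined by `⟨𝔖_β, 𝔖*_α⟩ = δ_{βα}`. -/
noncomputable def immaculate (β : Comp) : NSym :=
  Classical.epsilon (IsDualElement dualImmaculate β)

/-- The row-strict immaculate function `ℛ𝔖_β`, determined by `⟨ℛ𝔖_β, ℛ𝔖*_α⟩ = δ_{βα}`. -/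
noncomputable def rowStrictImmaculate (β : Comp) : NSym :=
  Classical.epsilon (IsDualElement rowStrictDualImmaculate β)

theorem degree_exponent (γ : Comp) (i : Fin γ.length → ℕ) :
    (Comp.exponent γ i).degree = Comp.size γ := by
  refine (degree_fillingWeight (fun t => (γ.get t : ℕ)) i).trans ?_
  rw [Comp.size, ← List.sum_ofFn]
  congr 1
  refine List.ext_get (by simp) fun n h1 h2 => by simp

theorem finite_size_le (N : ℕ) : {γ : Comp | Comp.size γ ≤ N}.Finite := by
  have hsub : {γ : Comp | Comp.size γ ≤ N} ⊆ (fun l : List ℕ => l.map Nat.succPNat) ''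
      ⋃ n : Fin (N + 1), Set.range fun c : Composition n => c.blocks.map Nat.pred := by
    intro γ hγ
    refine ⟨(γ.map fun a : ℕ+ => (a : ℕ)).map Nat.pred, ?_, ?_⟩
    · refine Set.mem_iUnion.2 ⟨⟨Comp.size γ, Nat.lt_succ_of_le hγ⟩,
        ⟨γ.map fun a : ℕ+ => (a : ℕ), ?_, rfl⟩, rfl⟩
      intro i hi
      obtain ⟨a, -, rfl⟩ := List.mem_map.1 hi
      exact a.pos
    · simp only [List.map_map]
      conv_rhs => rw [← List.map_id γ]
      refine List.map_congr_left fun a _ => ?_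
      exact PNat.succPNat_natPred a
  exact ((Set.finite_iUnion fun n => Set.finite_range _).image _).subset hsub

/-- The sums that define the skew functions are finite. -/
theorem finite_support_pairing (g : NSym) (f : QSym) :
    (Function.support fun γ : Comp => pairing (g * nchComp γ) f • monomialQSym γ).Finite := by
  obtain ⟨N, hN⟩ := f.2.1
  refine (finite_size_le N).subset fun γ hγ => ?_
  by_contra hlt
  rw [Set.mem_ofPred_eq, not_le] at hlt
  refine hγ ?_
  have h0 : (pairing.flip f).comp (LinearMap.mulRight ℚ (nchComp γ)) = 0 := by
    refine nchBasis.ext fun δ => ?_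
    simp only [LinearMap.comp_apply, LinearMap.flip_apply, LinearMap.mulRight_apply,
      nchBasis_apply, ← nchComp_append, pairing_nchComp, LinearMap.zero_apply]
    by_contra h
    have h1 := hN _ h
    rw [degree_exponent] at h1
    simp [Comp.size] at h1 hlt
    omega
  have h1 : pairing (g * nchComp γ) f = 0 := LinearMap.congr_fun h0 g
  simp [h1]

/-- The skew dual immaculate function `𝔖*_{α/β} = ∑_γ ⟨𝔖_β h_γ, 𝔖*_α⟩ M_γ`, the sum being over all
compositions `γ`; only finitely many terms are nonzero. -/
noncomputable def skewDualImmaculate (α β : Comp) : QSym :=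
  ∑ᶠ γ : Comp, pairing (immaculate β * nchComp γ) (dualImmaculate α) • monomialQSym γ

/-- The skew row-strict dual immaculate function
`ℛ𝔖*_{α/β} = ∑_γ ⟨ℛ𝔖_β h_γ, ℛ𝔖*_α⟩ M_γ`, the sum being over all compositions `γ`; only finitely
many terms are nonzero. -/
noncomputable def skewRowStrictDualImmaculate (α β : Comp) : QSym :=
  ∑ᶠ γ : Comp,
    pairing (rowStrictImmaculate β * nchComp γ) (rowStrictDualImmaculate α) • monomialQSym γ

/-! ### Compositions and their diagrams -/

namespace Comp

/-! Both families are fillings whose first column is governed by a relation `P` and whose rows by a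
relation `Q`, one of them `<` and the other `≤`; `IsShiftOrder` records all that the common argument
uses. Pairing `h_γ` with such a function counts tableaux of content `γ`. In a tableau of shape `α`
and content `η ++ γ` the entries below `ℓ(η)` occupy the diagram of some `δ ⊆ α`, and the others,
lowered by `ℓ(η)`, form a tableau of shape `α/δ`; the conditions between the two pieces hold
automatically (`tableauCount_append`). By linearity in `g`, `⟨g h_γ, f_α⟩ = ∑_δ K(α/δ, γ) ⟨g, f_δ⟩`,
where `K` counts tableaux (`pairing_mul_nchComp`). If `g` is dual to `f_β`, only `δ = β` survives,
and `K(α/β, γ)` is the coefficient of `M_γ` in the skew generating function.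

It remains to find the dual elements. For the immaculate family the matrix `K` is unitriangular with
respect to the sum of the entries, so it can be inverted. The row-strict matrix can vanish on the
diagonal (a row of two cells has no row-strict filling with equal entries), so the result is
transported instead: the involution `nsymPsi`, `e_n ↦ h_n`, satisfies `⟨ψ(g), ℛ𝔖*_α⟩ = ⟨g, 𝔖*_α⟩`
(`pairing_nsymPsi`). This compares Pieri rules. Multiplying by `h_m` strips off `m` cells, at most
one in the first column for `𝔖*`, at most one in every row for `ℛ𝔖*`. That `e_m` acts on `ℛ𝔖*` by
the first rule follows from `∑ (-1)^a e_a h_b = 0` and a sign-reversing involution that toggles one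
cell (`sum_isIntermediate_eq_zero`). -/

theorem part_eq_zero {α : Comp} {i : ℕ} (h : α.length ≤ i) : part α i = 0 := by
  simp [part, h]

theorem part_eq_getElem {α : Comp} {i : ℕ} (h : i < α.length) : part α i = (α[i] : ℕ) := by
  simp [part, h]

theorem part_pos_iff {α : Comp} {i : ℕ} : 0 < part α i ↔ i < α.length := by
  constructor
  · intro h
    by_contra h'
    rw [part_eq_zero (not_lt.1 h')] at h
    exact h.false
  · intro h
    rw [part_eq_getElem h]
    exact PNat.pos _

theorem ext_part {α β : Comp} (h : ∀ i, part α i = part β i) : α = β := by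
  have hl : α.length = β.length := by
    refine le_antisymm ?_ ?_ <;> by_contra! hlt
    · have := part_pos_iff.2 hlt
      rw [h] at this
      exact lt_irrefl _ (part_pos_iff.1 this)
    · have := part_pos_iff.2 hlt
      rw [← h] at this
      exact lt_irrefl _ (part_pos_iff.1 this)
  refine List.ext_getElem hl fun i h1 h2 => PNat.coe_injective ?_
  rw [← part_eq_getElem h1, ← part_eq_getElem h2, h]

theorem part_append (α β : Comp) (i : ℕ) :
    part (α ++ β) i = if i < α.length then part α i else part β (i - α.length) := by
  split_ifs with h
  · rw [part_eq_getElem h, part_eq_getElem (by simp; omega), List.getElem_append_left h]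
  · simp only [part, List.map_append]
    rw [List.getD_append_right _ _ _ _ (by simpa using h)]
    simp

theorem mem_diagram {α : Comp} {c : ℕ × ℕ} : c ∈ diagram α ↔ c.2 < part α c.1 := by
  obtain ⟨i, j⟩ := c
  simp only [diagram, Finset.mem_biUnion, Finset.mem_range, Finset.mem_product,
    Finset.mem_singleton]
  constructor
  · rintro ⟨_, _, rfl, h⟩
    exact h
  · intro h
    exact ⟨i, part_pos_iff.1 (by omega), rfl, h⟩

theorem mem_diagram_of_le {α : Comp} {i j j' : ℕ} (h : (i, j) ∈ diagram α) (hj : j' ≤ j) :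
    (i, j') ∈ diagram α := by
  rw [mem_diagram] at h ⊢
  exact hj.trans_lt h

theorem mem_diagram_zero {α : Comp} {i : ℕ} : (i, 0) ∈ diagram α ↔ i < α.length :=
  mem_diagram.trans part_pos_iff

theorem diagram_injective : Function.Injective diagram := by
  intro α β h
  refine ext_part fun i => ?_
  have key : ∀ j, j < part α i ↔ j < part β i := fun j => by
    rw [← mem_diagram (c := (i, j)), ← mem_diagram (c := (i, j)), h]
  have h1 := key (part α i)
  have h2 := key (part β i)
  omega

theorem contained_iff {β α : Comp} : Contained β α ↔ diagram β ⊆ diagram α := by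
  constructor
  · rintro ⟨-, h⟩ c hc
    rw [mem_diagram] at hc ⊢
    exact hc.trans_le (h _ (part_pos_iff.1 (by omega)))
  · intro h
    refine ⟨?_, fun i _ => ?_⟩
    · by_contra! hlt
      exact lt_irrefl _ (mem_diagram_zero.1 (h (mem_diagram_zero.2 hlt)))
    · by_contra! hlt
      exact lt_irrefl _ (mem_diagram.1 (h (mem_diagram (c := (i, part α i)).2 hlt)))

theorem exists_forall_mem_iff_lt (s : Finset ℕ) (hs : ∀ i ∈ s, ∀ j ≤ i, j ∈ s) :
    ∃ n, ∀ i, i ∈ s ↔ i < n := by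
  classical
  have hex : ∃ n, n ∉ s := Infinite.exists_notMem_finset s
  refine ⟨Nat.find hex, fun i => ⟨fun hi => ?_, fun hi => not_not.1 (Nat.find_min hex hi)⟩⟩
  by_contra! h
  exact Nat.find_spec hex (hs i hi _ h)

/-- A finite set of cells is a diagram if its rows and its first column have no gaps. -/
theorem exists_diagram_eq (D : Finset (ℕ × ℕ))
    (hrow : ∀ i j, (i, j) ∈ D → ∀ j' ≤ j, (i, j') ∈ D)
    (hcol : ∀ i, (i, 0) ∈ D → ∀ i' ≤ i, (i', 0) ∈ D) : ∃ δ : Comp, diagram δ = D := by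
  classical
  have h1 : ∀ i, ∃ n, ∀ j, (i, j) ∈ D ↔ j < n := by
    intro i
    obtain ⟨n, hn⟩ := exists_forall_mem_iff_lt ((D.filter fun c => c.1 = i).image Prod.snd) (by
      simp only [Finset.mem_image, Finset.mem_filter, Prod.exists]
      rintro j ⟨i', _, ⟨h, rfl⟩, rfl⟩ j' hj'
      exact ⟨i', j', ⟨hrow _ _ h _ hj', rfl⟩, rfl⟩)
    refine ⟨n, fun j => ?_⟩
    rw [← hn]
    simp
  choose r hr using h1
  obtain ⟨L, hL⟩ := exists_forall_mem_iff_lt ((D.filter fun c => c.2 = 0).image Prod.fst) (by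
    simp only [Finset.mem_image, Finset.mem_filter, Prod.exists]
    rintro i ⟨_, j, ⟨h, rfl⟩, rfl⟩ i' hi'
    exact ⟨i', 0, ⟨hcol _ h _ hi', rfl⟩, rfl⟩)
  have hpos : ∀ i, 0 < r i ↔ i < L := fun i => by
    rw [← hL, ← hr i 0]
    simp
  -- The nonempty rows are exactly those below `L`, the height of the first column, so their lengths
  -- are the parts of a composition.
  choose f hf using fun i : Fin L => (⟨⟨r i, (hpos i).2 i.2⟩, rfl⟩ : ∃ a : ℕ+, (a : ℕ) = r i)
  refine ⟨List.ofFn f, ?_⟩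
  ext ⟨i, j⟩
  rw [mem_diagram, hr]
  by_cases hi : i < L
  · rw [part_eq_getElem (by simpa using hi)]
    simp [hf]
  · rw [part_eq_zero (by simpa using hi)]
    have := (hpos i).not.2 hi
    simp only
    omega

/-- The compositions contained in `α`. -/
noncomputable def subs (α : Comp) : Finset Comp :=
  (diagram α).powerset.preimage diagram diagram_injective.injOn

theorem mem_subs {δ α : Comp} : δ ∈ subs α ↔ diagram δ ⊆ diagram α := by
  simp [subs]

/-- The exponent of `x_1^{γ₁} ⋯ x_k^{γ_k}`. -/
noncomputable def expo (γ : Comp) : ℕ →₀ ℕ := exponent γ fun t => (t : ℕ)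

theorem expo_apply (γ : Comp) (n : ℕ) : expo γ n = part γ n := by
  rw [expo, exponent, Finsupp.finsetSum_apply]
  by_cases h : n < γ.length
  · rw [Finset.sum_eq_single ⟨n, h⟩]
    · simp [part_eq_getElem h]
    · intro t _ ht
      exact Finsupp.single_eq_of_ne fun h' => ht (Fin.ext h'.symm)
    · simp
  · rw [part_eq_zero (not_lt.1 h)]
    refine Finset.sum_eq_zero fun t _ => Finsupp.single_eq_of_ne fun h' => ?_
    omega

theorem expo_injective : Function.Injective expo := fun α β h =>
  ext_part fun i => by rw [← expo_apply, h, expo_apply]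

theorem expo_append (η γ : Comp) :
    expo (η ++ γ) = expo η + (expo γ).mapDomain (· + η.length) := by
  ext n
  rw [expo_apply, part_append, Finsupp.add_apply, expo_apply]
  split_ifs with h
  · rw [Finsupp.mapDomain_of_notMem_range, add_zero]
    rintro ⟨m, hm⟩
    simp only at hm
    omega
  · obtain ⟨m, rfl⟩ := Nat.exists_eq_add_of_le' (not_lt.1 h)
    have := Finsupp.mapDomain_apply (add_left_injective η.length) (expo γ) m
    rw [part_eq_zero (not_lt.1 h), zero_add, this, expo_apply, Nat.add_sub_cancel]

/-- Listing the support of `m` in increasing order gives `i`, and the values there give `γ`. Thus a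
quasisymmetric function is determined by its coefficients at the `expo γ`. -/
theorem exists_exponent_eq (m : ℕ →₀ ℕ) :
    ∃ (γ : Comp) (i : Fin γ.length → ℕ), StrictMono i ∧ exponent γ i = m := by
  classical
  let e := m.support.orderEmbOfFin rfl
  choose f hf using fun t => (⟨⟨m (e t), Nat.pos_of_ne_zero (Finsupp.mem_support_iff.1
    (Finset.orderEmbOfFin_mem m.support rfl t))⟩, rfl⟩ : ∃ a : ℕ+, (a : ℕ) = m (e t))
  have hl : (List.ofFn f).length = m.support.card := List.length_ofFn
  refine ⟨List.ofFn f, fun t => e (Fin.cast hl t), fun a b h => e.strictMono (by simpa using h), ?_⟩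
  have h1 : exponent (List.ofFn f) (fun t => e (Fin.cast hl t)) =
      ∑ t, Finsupp.single (e t) (m (e t)) := by
    rw [exponent]
    refine Fintype.sum_equiv (finCongr hl) _ _ fun t => ?_
    simp [hf, Fin.cast]
  rw [h1]
  conv_rhs => rw [← Finsupp.sum_single m, Finsupp.sum, ← Finset.map_orderEmbOfFin_univ m.support rfl,
    Finset.sum_map]
  rfl

end Comp

/-! ### Fillings with prescribed relations in the first column and in the rows -/

/-- A relation on `ℕ` that lies between `<` and `≤` and is invariant under shifts. -/
structure IsShiftOrder (P : ℕ → ℕ → Prop) : Prop where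
  of_lt : ∀ a b, a < b → P a b
  le : ∀ a b, P a b → a ≤ b
  shift : ∀ a b k, P (a + k) (b + k) ↔ P a b

theorem isShiftOrder_lt : IsShiftOrder (· < ·) :=
  ⟨fun _ _ h => h, fun _ _ h => h.le, fun _ _ _ => Nat.add_lt_add_iff_right⟩

theorem isShiftOrder_le : IsShiftOrder (· ≤ ·) :=
  ⟨fun _ _ h => h.le, fun _ _ h => h, fun _ _ _ => Nat.add_le_add_iff_right⟩

/-- The entries in the first column are related by `P` from bottom to top, those in a row are
related by `Q` from left to right. -/
def IsTableau (P Q : ℕ → ℕ → Prop) {D : Finset (ℕ × ℕ)} (T : D → ℕ) : Prop :=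
  (∀ c d : D, c.1.2 = 0 → d.1.2 = 0 → c.1.1 < d.1.1 → P (T c) (T d)) ∧
    ∀ c d : D, c.1.1 = d.1.1 → c.1.2 < d.1.2 → Q (T c) (T d)

/-- The tableaux of content `m` with the cells `D`. -/
abbrev TableauOfContent (P Q : ℕ → ℕ → Prop) (D : Finset (ℕ × ℕ)) (m : ℕ →₀ ℕ) :=
  {T : {T : D → ℕ // IsTableau P Q T} // content T.1 = m}

/-- The number of tableaux of content `m` with the cells `D`. -/
noncomputable def tableauCount (P Q : ℕ → ℕ → Prop) (D : Finset (ℕ × ℕ)) (m : ℕ →₀ ℕ) : ℕ :=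
  Nat.card (TableauOfContent P Q D m)

instance finite_tableauOfContent (P Q : ℕ → ℕ → Prop) (D : Finset (ℕ × ℕ)) (m : ℕ →₀ ℕ) :
    Finite (TableauOfContent P Q D m) :=
  finite_fillingWeight (w := fun _ => 1) (fun _ => one_pos) _ m

/-! ### Gluing fillings of `E` and of `D \ E` -/

section Glue

variable {D E : Finset (ℕ × ℕ)}

theorem content_apply_eq_zero {T : D → ℕ} {n : ℕ} : content T n = 0 ↔ ∀ c, T c ≠ n := by
  have := (support_fillingWeight (w := fun _ : D => 1) (fun _ => one_pos) T n).not
  rw [Finsupp.notMem_support_iff, not_exists] at this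
  exact this

theorem lt_length_of_content {η : Comp} {T : D → ℕ} (h : content T = Comp.expo η) (c : D) :
    T c < η.length := by
  by_contra! hc
  refine content_apply_eq_zero.1 (?_ : content T (T c) = 0) c rfl
  rw [h, Comp.expo_apply, Comp.part_eq_zero hc]

theorem degree_content (T : D → ℕ) : (content T).degree = D.card := by
  refine (degree_fillingWeight (fun _ : D => 1) T).trans ?_
  simp

/-- The filling of `D` that is `T₁` on `E` and `T₂ + k` outside. -/
def glue (k : ℕ) (T₁ : E → ℕ) (T₂ : ↥(D \ E) → ℕ) (c : D) : ℕ :=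
  if h : c.1 ∈ E then T₁ ⟨c.1, h⟩ else T₂ ⟨c.1, Finset.mem_sdiff.2 ⟨c.2, h⟩⟩ + k

theorem glue_of_mem {k : ℕ} {T₁ : E → ℕ} {T₂ : ↥(D \ E) → ℕ} {c : D} (h : c.1 ∈ E) :
    glue k T₁ T₂ c = T₁ ⟨c.1, h⟩ := dif_pos h

theorem glue_of_notMem {k : ℕ} {T₁ : E → ℕ} {T₂ : ↥(D \ E) → ℕ} {c : D} (h : c.1 ∉ E) :
    glue k T₁ T₂ c = T₂ ⟨c.1, Finset.mem_sdiff.2 ⟨c.2, h⟩⟩ + k := dif_neg h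

theorem glue_inj (hED : E ⊆ D) {k : ℕ} {T₁ S₁ : E → ℕ} {T₂ S₂ : ↥(D \ E) → ℕ}
    (h : glue k T₁ T₂ = glue k S₁ S₂) : T₁ = S₁ ∧ T₂ = S₂ := by
  constructor
  · funext c
    have := congrFun h ⟨c.1, hED c.2⟩
    rwa [glue_of_mem (c := ⟨c.1, hED c.2⟩) c.2, glue_of_mem (c := ⟨c.1, hED c.2⟩) c.2] at this
  · funext c
    have hc := Finset.mem_sdiff.1 c.2
    have := congrFun h ⟨c.1, hc.1⟩
    rw [glue_of_notMem (c := ⟨c.1, hc.1⟩) hc.2, glue_of_notMem (c := ⟨c.1, hc.1⟩) hc.2] at this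
    exact Nat.add_right_cancel this

theorem content_glue (hED : E ⊆ D) (k : ℕ) (T₁ : E → ℕ) (T₂ : ↥(D \ E) → ℕ) :
    content (glue k T₁ T₂) = content T₁ + (content T₂).mapDomain (· + k) := by
  classical
  -- Extended by `0` outside `D`, a value never used, so that all three contents become sums over
  -- sets of cells of the plane.
  let t : ℕ × ℕ → ℕ := fun c => if h : c ∈ D then glue k T₁ T₂ ⟨c, h⟩ else 0
  have h0 : content (glue k T₁ T₂) = ∑ c ∈ D, Finsupp.single (t c) 1 := by
    rw [← Finset.sum_coe_sort]
    exact Finset.sum_congr rfl fun c _ => by simp [t]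
  have h1 : content T₁ = ∑ c ∈ E, Finsupp.single (t c) 1 := by
    rw [← Finset.sum_coe_sort]
    refine Finset.sum_congr rfl fun c _ => ?_
    simp only [t, dif_pos (hED c.2)]
    rw [glue_of_mem (c := ⟨c.1, hED c.2⟩) c.2]
  have h2 : (content T₂).mapDomain (· + k) = ∑ c ∈ D \ E, Finsupp.single (t c) 1 := by
    rw [content, Finsupp.mapDomain_finsetSum, ← Finset.sum_coe_sort (D \ E)]
    refine Finset.sum_congr rfl fun c _ => ?_
    have hc := Finset.mem_sdiff.1 c.2
    simp only [t, dif_pos hc.1, glue_of_notMem (c := ⟨c.1, hc.1⟩) hc.2, Finsupp.mapDomain_single]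
  rw [h0, h1, h2, add_comm, Finset.sum_sdiff hED]

/-- As `E` is closed downwards in rows and in the first column, a comparison between the two pieces
always goes from a cell of `E` to a cell outside. The first entry is less than `k` and the second at
least `k`, so `of_lt` applies; within a piece, shift invariance suffices. -/
theorem isTableau_glue {P Q : ℕ → ℕ → Prop} (hP : IsShiftOrder P) (hQ : IsShiftOrder Q)
    (hrow : ∀ i j, (i, j) ∈ E → ∀ j' ≤ j, (i, j') ∈ E)
    (hcol : ∀ i, (i, 0) ∈ E → ∀ i' ≤ i, (i', 0) ∈ E)
    {k : ℕ} {T₁ : E → ℕ} {T₂ : ↥(D \ E) → ℕ} (h₁ : IsTableau P Q T₁) (h₂ : IsTableau P Q T₂)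
    (hk : ∀ c, T₁ c < k) : IsTableau P Q (glue k T₁ T₂) := by
  have aux : ∀ {R : ℕ → ℕ → Prop}, IsShiftOrder R → ∀ c d : D, (d.1 ∈ E → c.1 ∈ E) →
      (∀ hc hd, R (T₁ ⟨c.1, hc⟩) (T₁ ⟨d.1, hd⟩)) → (∀ hc hd, R (T₂ ⟨c.1, hc⟩) (T₂ ⟨d.1, hd⟩)) →
      R (glue k T₁ T₂ c) (glue k T₁ T₂ d) := by
    intro R hR c d hcd hr₁ hr₂
    by_cases hd : d.1 ∈ E
    · rw [glue_of_mem hd, glue_of_mem (hcd hd)]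
      exact hr₁ _ _
    · rw [glue_of_notMem hd]
      by_cases hc : c.1 ∈ E
      · rw [glue_of_mem hc]
        exact hR.of_lt _ _ ((hk _).trans_le (Nat.le_add_left _ _))
      · rw [glue_of_notMem hc, hR.shift]
        exact hr₂ _ _
  refine ⟨fun c d hc hd hcd => ?_, fun c d hc hcd => ?_⟩
  · refine aux hP c d (fun h => ?_) (fun _ _ => h₁.1 _ _ hc hd hcd) (fun _ _ => h₂.1 _ _ hc hd hcd)
    have := hcol d.1.1 (by rwa [← hd]) c.1.1 hcd.le
    rwa [← hc] at this
  · refine aux hQ c d (fun h => ?_) (fun _ _ => h₁.2 _ _ hc hcd) (fun _ _ => h₂.2 _ _ hc hcd)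
    have := hrow d.1.1 d.1.2 h c.1.2 hcd.le
    rwa [← hc] at this

end Glue

/-- The two summands live on disjoint ranges of exponents, below `k` and from `k` on. -/
theorem Finsupp.add_mapDomain_shift_inj {k : ℕ} {a a' b b' : ℕ →₀ ℕ} (ha : ∀ n, k ≤ n → a n = 0)
    (ha' : ∀ n, k ≤ n → a' n = 0)
    (h : a + b.mapDomain (· + k) = a' + b'.mapDomain (· + k)) : a = a' ∧ b = b' := by
  constructor
  · ext n
    rcases lt_or_ge n k with hn | hn
    · have hr : n ∉ Set.range (· + k) := by
        rintro ⟨m, hm⟩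
        simp only at hm
        omega
      have := DFunLike.congr_fun h n
      simpa [Finsupp.mapDomain_of_notMem_range _ _ hr] using this
    · rw [ha n hn, ha' n hn]
  · ext n
    have := DFunLike.congr_fun h (n + k)
    rw [Finsupp.add_apply, Finsupp.add_apply, ha _ (Nat.le_add_left _ _),
      ha' _ (Nat.le_add_left _ _), Finsupp.mapDomain_apply (add_left_injective k) b n,
      Finsupp.mapDomain_apply (add_left_injective k) b' n] at this
    simpa using this

/-- Cutting a tableau at the entries less than `ℓ(η)`. -/
theorem tableauCount_append {P Q : ℕ → ℕ → Prop} (hP : IsShiftOrder P) (hQ : IsShiftOrder Q)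
    (α η γ : Comp) :
    tableauCount P Q (Comp.diagram α) (Comp.expo (η ++ γ)) =
      ∑ δ ∈ Comp.subs α, tableauCount P Q (Comp.diagram δ) (Comp.expo η) *
        tableauCount P Q (Comp.skewDiagram α δ) (Comp.expo γ) := by
  classical
  change _ = ∑ δ ∈ Comp.subs α, tableauCount P Q (Comp.diagram δ) (Comp.expo η) *
    tableauCount P Q (Comp.diagram α \ Comp.diagram δ) (Comp.expo γ)
  let X := Σ δ : ↥(Comp.subs α), TableauOfContent P Q (Comp.diagram δ.1) (Comp.expo η) ×
    TableauOfContent P Q (Comp.diagram α \ Comp.diagram δ.1) (Comp.expo γ)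
  let Φ : X → TableauOfContent P Q (Comp.diagram α) (Comp.expo (η ++ γ)) := fun x =>
    ⟨⟨glue (E := Comp.diagram x.1.1) η.length x.2.1.1.1 x.2.2.1.1,
      isTableau_glue hP hQ (fun _ _ h _ h' => Comp.mem_diagram_of_le h h')
        (fun _ h _ h' => Comp.mem_diagram_zero.2 (h'.trans_lt (Comp.mem_diagram_zero.1 h)))
        x.2.1.1.2 x.2.2.1.2 (lt_length_of_content x.2.1.2)⟩, by
      refine (content_glue (Comp.mem_subs.1 x.1.2) _ _ _).trans ?_
      rw [Comp.expo_append, x.2.1.2]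
      exact congrArg _ (congrArg _ x.2.2.2)⟩
  -- The inner shape is recovered from the glued filling as the set of cells with entry below
  -- `ℓ(η)`; this gives injectivity of `Φ` on the index `δ`.
  have hmem : ∀ (x : X) (c : Comp.diagram α), (Φ x).1.1 c < η.length ↔ c.1 ∈ Comp.diagram x.1.1 := by
    intro x c
    change glue (E := Comp.diagram x.1.1) η.length x.2.1.1.1 x.2.2.1.1 c < _ ↔ _
    by_cases h : c.1 ∈ Comp.diagram x.1.1
    · rw [glue_of_mem h]
      exact iff_of_true (lt_length_of_content x.2.1.2 _) h
    · rw [glue_of_notMem h]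
      exact iff_of_false (by omega) h
  have hΦ : Function.Bijective Φ := by
    constructor
    · intro x y hxy
      have hδ : x.1 = y.1 := by
        refine Subtype.ext (Comp.diagram_injective (Finset.ext fun c => ?_))
        have aux : ∀ h : c ∈ Comp.diagram α,
            c ∈ Comp.diagram x.1.1 ↔ c ∈ Comp.diagram y.1.1 := fun h => by
          rw [← hmem x ⟨c, h⟩, ← hmem y ⟨c, h⟩, hxy]
        exact ⟨fun h => (aux (Comp.mem_subs.1 x.1.2 h)).1 h,
          fun h => (aux (Comp.mem_subs.1 y.1.2 h)).2 h⟩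
      obtain ⟨δ, T₁, T₂⟩ := x
      obtain ⟨δ', S₁, S₂⟩ := y
      obtain rfl : δ = δ' := hδ
      obtain ⟨e₁, e₂⟩ := glue_inj (Comp.mem_subs.1 δ.2)
        (congrArg (fun z => z.1.1) hxy : glue η.length T₁.1.1 T₂.1.1 = glue η.length S₁.1.1 S₂.1.1)
      obtain rfl : T₁ = S₁ := Subtype.ext (Subtype.ext e₁)
      obtain rfl : T₂ = S₂ := Subtype.ext (Subtype.ext e₂)
      rfl
    · rintro ⟨⟨T, hT⟩, hc⟩
      -- Since `P` and `Q` imply `≤`, the cells with small entries leave no gaps in the rows or in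
      -- the first column.
      obtain ⟨δ, hδ⟩ := Comp.exists_diagram_eq
        ((Comp.diagram α).filter fun c => ∃ h : c ∈ Comp.diagram α, T ⟨c, h⟩ < η.length) (by
          simp only [Finset.mem_filter]
          rintro i j ⟨-, h, h'⟩ j' hj
          refine ⟨Comp.mem_diagram_of_le h hj, Comp.mem_diagram_of_le h hj, ?_⟩
          rcases hj.lt_or_eq with hj | rfl
          · exact (hQ.le _ _ (hT.2 ⟨(i, j'), Comp.mem_diagram_of_le h hj.le⟩ ⟨(i, j), h⟩ rfl
              hj)).trans_lt h'
          · exact h') (by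
          simp only [Finset.mem_filter]
          rintro i ⟨-, h, h'⟩ i' hi
          have hm := Comp.mem_diagram_zero.2 (hi.trans_lt (Comp.mem_diagram_zero.1 h))
          refine ⟨hm, hm, ?_⟩
          rcases hi.lt_or_eq with hi | rfl
          · exact (hP.le _ _ (hT.1 ⟨(i', 0), hm⟩ ⟨(i, 0), h⟩ rfl rfl hi)).trans_lt h'
          · exact h')
      have hsub : Comp.diagram δ ⊆ Comp.diagram α := hδ ▸ Finset.filter_subset _ _
      have hlt : ∀ c : Comp.diagram α, c.1 ∈ Comp.diagram δ ↔ T c < η.length := fun c => by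
        rw [hδ, Finset.mem_filter]
        exact ⟨fun h => h.2.2, fun h => ⟨c.2, c.2, h⟩⟩
      let T₁ : Comp.diagram δ → ℕ := fun c => T ⟨c.1, hsub c.2⟩
      -- The subtraction does not truncate: outside `δ` all entries are at least `ℓ(η)`.
      let T₂ : ↥(Comp.diagram α \ Comp.diagram δ) → ℕ := fun c =>
        T ⟨c.1, (Finset.mem_sdiff.1 c.2).1⟩ - η.length
      have hT₂ : ∀ c, T₂ c + η.length = T ⟨c.1, (Finset.mem_sdiff.1 c.2).1⟩ := fun c => by
        have := (hlt ⟨c.1, (Finset.mem_sdiff.1 c.2).1⟩).not.1 (Finset.mem_sdiff.1 c.2).2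
        simp only [T₂]
        omega
      have hglue : glue η.length T₁ T₂ = T := by
        funext c
        by_cases h : c.1 ∈ Comp.diagram δ
        · rw [glue_of_mem h]
        · rw [glue_of_notMem h, hT₂]
      have hcont : content T₁ = Comp.expo η ∧ content T₂ = Comp.expo γ := by
        refine Finsupp.add_mapDomain_shift_inj (k := η.length) (fun n hn => ?_) (fun n hn => ?_) ?_
        · exact content_apply_eq_zero.2 fun c => (((hlt _).1 c.2).trans_le hn).ne
        · rw [Comp.expo_apply, Comp.part_eq_zero hn]
        · rw [← content_glue hsub, hglue, ← Comp.expo_append]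
          exact hc
      have ht₁ : IsTableau P Q T₁ := ⟨fun c d => hT.1 ⟨c.1, _⟩ ⟨d.1, _⟩,
        fun c d => hT.2 ⟨c.1, _⟩ ⟨d.1, _⟩⟩
      have ht₂ : IsTableau P Q T₂ := by
        refine ⟨fun c d h1 h2 h3 => ?_, fun c d h1 h2 => ?_⟩
        · rw [← hP.shift _ _ η.length, hT₂, hT₂]
          exact hT.1 _ _ h1 h2 h3
        · rw [← hQ.shift _ _ η.length, hT₂, hT₂]
          exact hT.2 _ _ h1 h2
      exact ⟨⟨⟨δ, Comp.mem_subs.2 hsub⟩, ⟨⟨T₁, ht₁⟩, hcont.1⟩, ⟨⟨T₂, ht₂⟩, hcont.2⟩⟩,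
        Subtype.ext (Subtype.ext hglue)⟩
  rw [tableauCount, ← Nat.card_congr (Equiv.ofBijective Φ hΦ), Nat.card_sigma,
    ← Finset.sum_coe_sort (Comp.subs α)]
  exact Finset.sum_congr rfl fun δ _ => Nat.card_prod _ _

/-! ### The pairing with generating functions of tableaux -/

/-- `f α` is the generating function of the tableaux of shape `α` with relations `P` and `Q`. -/
def IsTableauFamily (P Q : ℕ → ℕ → Prop) (f : Comp → QSym) : Prop :=
  ∀ α, (f α : MvPowerSeries ℕ ℚ) =
    generatingFunction fun T : {T : Comp.diagram α → ℕ // IsTableau P Q T} => content T.1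

theorem isTableauFamily_dualImmaculate : IsTableauFamily (· < ·) (· ≤ ·) dualImmaculate :=
  fun _ => rfl

theorem isTableauFamily_rowStrictDualImmaculate :
    IsTableauFamily (· ≤ ·) (· < ·) rowStrictDualImmaculate := fun _ => rfl

section Family

variable {P Q : ℕ → ℕ → Prop} {f : Comp → QSym}

theorem pairing_nchComp_family (hf : IsTableauFamily P Q f) (α γ : Comp) :
    pairing (nchComp γ) (f α) = tableauCount P Q (Comp.diagram α) (Comp.expo γ) := by
  rw [pairing_nchComp, hf]
  rfl

/-- Both sides are linear in `g`; on a basis element `h_η` the product is `h_{η ++ γ}`, and the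
formula is `tableauCount_append`. -/
theorem pairing_mul_nchComp (hP : IsShiftOrder P) (hQ : IsShiftOrder Q)
    (hf : IsTableauFamily P Q f) (g : NSym) (α γ : Comp) :
    pairing (g * nchComp γ) (f α) = ∑ δ ∈ Comp.subs α,
      (tableauCount P Q (Comp.skewDiagram α δ) (Comp.expo γ) : ℚ) * pairing g (f δ) := by
  have h : (pairing.flip (f α)).comp (LinearMap.mulRight ℚ (nchComp γ)) = ∑ δ ∈ Comp.subs α,
      (tableauCount P Q (Comp.skewDiagram α δ) (Comp.expo γ) : ℚ) • pairing.flip (f δ) := by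
    refine nchBasis.ext fun η => ?_
    simp only [LinearMap.comp_apply, LinearMap.flip_apply, LinearMap.mulRight_apply,
      LinearMap.sum_apply, LinearMap.smul_apply, nchBasis_apply, ← nchComp_append,
      pairing_nchComp_family hf, smul_eq_mul, tableauCount_append hP hQ]
    push_cast
    exact Finset.sum_congr rfl fun δ _ => mul_comm _ _
  simpa using LinearMap.congr_fun h g

theorem QSym.ext_pairing {f g : QSym}
    (h : ∀ γ, pairing (nchComp γ) f = pairing (nchComp γ) g) : f = g := by
  refine Subtype.ext (MvPowerSeries.ext fun m => ?_)
  obtain ⟨γ, i, hi, rfl⟩ := Comp.exists_exponent_eq m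
  rw [f.2.2 γ i hi, g.2.2 γ i hi, ← pairing_nchComp, ← pairing_nchComp, h]

/-- The monomial expansion of a quasisymmetric function. -/
theorem QSym.eq_finsum (f : QSym) :
    f = ∑ᶠ γ : Comp, pairing (nchComp γ) f • monomialQSym γ := by
  refine QSym.ext_pairing fun δ => ?_
  have hfin := finite_support_pairing 1 f
  simp only [one_mul] at hfin
  rw [map_finsum _ hfin, finsum_eq_single _ δ fun γ hγ => ?_]
  · simp [pairing_nchComp_monomialQSym]
  · simp [pairing_nchComp_monomialQSym, hγ.symm]

/-- Such a relation depends only on relative order: it holds for `a < b`, and for `a = b` shifting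
decides it uniformly. This is what makes the tableau generating functions quasisymmetric. -/
theorem IsShiftOrder.of_le_iff (hP : IsShiftOrder P) {a b a' b' : ℕ} (h : a ≤ b ↔ a' ≤ b')
    (h' : b ≤ a ↔ b' ≤ a') (hab : P a b) : P a' b' := by
  rcases (h.1 (hP.le _ _ hab)).lt_or_eq with hlt | rfl
  · exact hP.of_lt _ _ hlt
  · obtain rfl : a = b := le_antisymm (h.2 le_rfl) (h'.2 le_rfl)
    rcases le_total a a' with hle | hle
    · obtain ⟨k, rfl⟩ := Nat.exists_eq_add_of_le hle
      exact (hP.shift _ _ k).2 hab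
    · obtain ⟨k, rfl⟩ := Nat.exists_eq_add_of_le hle
      exact (hP.shift _ _ k).1 hab

theorem generatingFunction_tableau_mem_QSym (hP : IsShiftOrder P) (hQ : IsShiftOrder Q)
    (D : Finset (ℕ × ℕ)) :
    generatingFunction (fun T : {T : D → ℕ // IsTableau P Q T} => content T.1) ∈ QSym :=
  generatingFunction_mem_QSym (w := fun _ => 1) (fun _ => one_pos) fun _ _ h hT =>
    ⟨fun c d h1 h2 h3 => hP.of_le_iff (h c d) (h d c) (hT.1 c d h1 h2 h3),
      fun c d h1 h2 => hQ.of_le_iff (h c d) (h d c) (hT.2 c d h1 h2)⟩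

/-- The skew function of `α/β` is the generating function of the tableaux of shape `α/β`. -/
theorem finsum_pairing_mul_nchComp (hP : IsShiftOrder P) (hQ : IsShiftOrder Q)
    (hf : IsTableauFamily P Q f) {α β : Comp} (hβα : Comp.Contained β α) {g : NSym}
    (hg : IsDualElement f β g) :
    ((∑ᶠ γ : Comp, pairing (g * nchComp γ) (f α) • monomialQSym γ : QSym) : MvPowerSeries ℕ ℚ) =
      generatingFunction
        fun T : {T : Comp.skewDiagram α β → ℕ // IsTableau P Q T} => content T.1 := by
  have hmem := generatingFunction_tableau_mem_QSym hP hQ (Comp.skewDiagram α β)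
  have key : ∀ γ, pairing (g * nchComp γ) (f α) = pairing (nchComp γ) ⟨_, hmem⟩ := by
    intro γ
    rw [pairing_mul_nchComp hP hQ hf, pairing_nchComp, Finset.sum_eq_single β]
    · rw [hg, if_pos rfl, mul_one]
      rfl
    · intro δ _ hδ
      rw [hg, if_neg hδ.symm, mul_zero]
    · exact fun h => (h (Comp.mem_subs.2 (Comp.contained_iff.1 hβα))).elim
  simp_rw [key]
  rw [← QSym.eq_finsum]

end Family

/-! ### Tableaux with only one entry -/

section OneEntry

variable {P Q : ℕ → ℕ → Prop}

theorem content_zero (D : Finset (ℕ × ℕ)) :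
    content (fun _ : D => 0) = Finsupp.single 0 D.card := by
  simp [content]

/-- Content concentrated at the entry `0` forces the constant filling, so the count is `0` or `1`.
-/
theorem tableauCount_single (P Q : ℕ → ℕ → Prop) (D : Finset (ℕ × ℕ)) (m : ℕ)
    [Decidable (IsTableau P Q fun _ : D => 0)] :
    tableauCount P Q D (Finsupp.single 0 m) =
      if D.card = m ∧ IsTableau P Q (fun _ : D => 0) then 1 else 0 := by
  have hT : ∀ T : D → ℕ, content T = Finsupp.single 0 m → T = fun _ => 0 := by
    intro T hT
    funext c
    by_contra hc
    refine content_apply_eq_zero.1 (?_ : content T (T c) = 0) c rfl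
    rw [hT, Finsupp.single_eq_of_ne hc]
  split_ifs with h
  · refine Nat.card_eq_one_iff_unique.2 ⟨⟨fun S T => Subtype.ext (Subtype.ext ?_)⟩,
      ⟨⟨⟨_, h.2⟩, by rw [content_zero, h.1]⟩⟩⟩
    rw [hT _ S.2, hT _ T.2]
  · have : IsEmpty (TableauOfContent P Q D (Finsupp.single 0 m)) := by
      refine ⟨fun T => h ⟨?_, ?_⟩⟩
      · rw [← degree_content T.1.1, T.2]
        simp
      · rw [← hT _ T.2]
        exact T.1.2
    exact Nat.card_of_isEmpty

/-- Since `h_0 = 1` is indexed by the empty composition rather than by a part `0`, this treats all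
`m` uniformly. -/
theorem exists_nchComp_eq (m : ℕ) :
    ∃ γ : Comp, nch m = nchComp γ ∧ Comp.expo γ = Finsupp.single 0 m := by
  rcases Nat.eq_zero_or_pos m with rfl | hm
  · refine ⟨[], by simp [nchComp, nch_zero], ?_⟩
    ext n
    simp [Comp.expo_apply, Comp.part]
  · lift m to ℕ+ using hm
    refine ⟨[m], by simp [nchComp], ?_⟩
    ext n
    cases n <;> simp [Comp.expo_apply, Comp.part]

/-- There is at most one cell in the first column. -/
def AtMostOneInFirstColumn (D : Finset (ℕ × ℕ)) : Prop :=
  ∀ i i', (i, 0) ∈ D → (i', 0) ∈ D → i = i'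

/-- There is at most one cell in every row. -/
def AtMostOneInRow (D : Finset (ℕ × ℕ)) : Prop :=
  ∀ i j j', (i, j) ∈ D → (i, j') ∈ D → j = j'

theorem isTableau_lt_le_zero (D : Finset (ℕ × ℕ)) :
    IsTableau (· < ·) (· ≤ ·) (fun _ : D => 0) ↔ AtMostOneInFirstColumn D := by
  constructor
  · intro h i i' hi hi'
    rcases lt_trichotomy i i' with hlt | rfl | hlt
    · exact (lt_irrefl 0 (h.1 ⟨_, hi⟩ ⟨_, hi'⟩ rfl rfl hlt)).elim
    · rfl
    · exact (lt_irrefl 0 (h.1 ⟨_, hi'⟩ ⟨_, hi⟩ rfl rfl hlt)).elim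
  · intro h
    refine ⟨?_, fun _ _ _ _ => le_rfl⟩
    rintro ⟨⟨i, j⟩, hc⟩ ⟨⟨i', j'⟩, hd⟩ (rfl : j = 0) (rfl : j' = 0) hlt
    exact (hlt.ne (h _ _ hc hd)).elim

theorem isTableau_le_lt_zero (D : Finset (ℕ × ℕ)) :
    IsTableau (· ≤ ·) (· < ·) (fun _ : D => 0) ↔ AtMostOneInRow D := by
  constructor
  · intro h i j j' hi hi'
    rcases lt_trichotomy j j' with hlt | rfl | hlt
    · exact (lt_irrefl 0 (h.2 ⟨_, hi⟩ ⟨_, hi'⟩ rfl hlt)).elim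
    · rfl
    · exact (lt_irrefl 0 (h.2 ⟨_, hi'⟩ ⟨_, hi⟩ rfl hlt)).elim
  · intro h
    refine ⟨fun _ _ _ _ _ => le_rfl, ?_⟩
    rintro ⟨⟨i, j⟩, hc⟩ ⟨⟨i', j'⟩, hd⟩ (rfl : i = i') hlt
    exact (hlt.ne (h _ _ _ hc hd)).elim

/-- The Pieri rule: the coefficient for `α/δ` asks whether the constant filling is a tableau, and
`R` expresses this as a condition on the shape. -/
theorem pairing_mul_nch {f : Comp → QSym} (hP : IsShiftOrder P) (hQ : IsShiftOrder Q)
    (hf : IsTableauFamily P Q f) {R : Finset (ℕ × ℕ) → Prop} [DecidablePred R]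
    (hR : ∀ D : Finset (ℕ × ℕ), IsTableau P Q (fun _ : D => 0) ↔ R D) (g : NSym) (m : ℕ) (α : Comp) :
    pairing (g * nch m) (f α) = ∑ δ ∈ Comp.subs α,
      (if (Comp.skewDiagram α δ).card = m ∧ R (Comp.skewDiagram α δ) then 1 else 0 : ℚ) *
        pairing g (f δ) := by
  classical
  obtain ⟨γ, h1, h2⟩ := exists_nchComp_eq m
  rw [h1, pairing_mul_nchComp hP hQ hf, h2]
  refine Finset.sum_congr rfl fun δ _ => ?_
  rw [tableauCount_single]
  simp only [hR, Nat.cast_ite, Nat.cast_one, Nat.cast_zero]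

end OneEntry

/-! ### Immaculate functions -/

/-- The sum of the entries of a filling of content `m`. -/
noncomputable def entrySum (m : ℕ →₀ ℕ) : ℕ := m.sum fun n a => a * n

theorem entrySum_content {D : Finset (ℕ × ℕ)} (T : D → ℕ) : entrySum (content T) = ∑ c, T c := by
  rw [entrySum, content, ← Finsupp.sum_finsetSum_index (by simp) (by intros; ring)]
  simp

theorem content_row (α : Comp) :
    content (fun c : Comp.diagram α => c.1.1) = Comp.expo α := by
  ext n
  rw [Comp.expo_apply, content, Finset.sum_coe_sort (Comp.diagram α)
    (fun c : ℕ × ℕ => Finsupp.single c.1 1), Finsupp.finsetSum_apply]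
  simp only [Finsupp.single_apply]
  rw [← Finset.card_filter, ← Finset.card_range (Comp.part α n),
    ← Finset.card_image_of_injective (Finset.range _) (Prod.mk_right_injective n)]
  congr 1
  ext ⟨i, j⟩
  simp only [Finset.mem_filter, Comp.mem_diagram, Finset.mem_image, Finset.mem_range, Prod.mk.injEq]
  constructor
  · rintro ⟨h, rfl⟩
    exact ⟨j, h, rfl, rfl⟩
  · rintro ⟨_, h, rfl, rfl⟩
    exact ⟨h, rfl⟩

/-- The first column increases strictly from a value at least `0`, and the rows increase weakly. So
the filling by row numbers is the smallest immaculate tableau. -/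
theorem row_le_of_isTableau {α : Comp} {T : Comp.diagram α → ℕ}
    (hT : IsTableau (· < ·) (· ≤ ·) T) (c : Comp.diagram α) : c.1.1 ≤ T c := by
  have h : ∀ i (hi : (i, 0) ∈ Comp.diagram α), i ≤ T ⟨(i, 0), hi⟩ := by
    intro i
    induction i with
    | zero => exact fun _ => Nat.zero_le _
    | succ i ih =>
      intro hi
      have hi' : (i, 0) ∈ Comp.diagram α := by
        rw [Comp.mem_diagram_zero] at hi ⊢
        omega
      exact (ih hi').trans_lt (hT.1 ⟨_, hi'⟩ ⟨_, hi⟩ rfl rfl (Nat.lt_succ_self i))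
  obtain ⟨⟨i, j⟩, hc⟩ := c
  have h0 := Comp.mem_diagram_of_le hc (Nat.zero_le _)
  refine (h i h0).trans ?_
  rcases Nat.eq_zero_or_pos j with rfl | hj
  · exact le_rfl
  · exact hT.2 ⟨_, h0⟩ ⟨_, hc⟩ rfl hj

theorem isTableau_row (α : Comp) :
    IsTableau (· < ·) (· ≤ ·) fun c : Comp.diagram α => c.1.1 :=
  ⟨fun _ _ _ _ h => h, fun _ _ h _ => h.le⟩

/-- The row filling is the pointwise minimum, so a tableau whose entry sum does not exceed the
minimal one coincides with it. This yields the unitriangularity: off the diagonal, a nonzero pairing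
of `h_γ` with `𝔖*_α` forces a larger entry sum for `γ` than for `α`. -/
theorem eq_row_of_content {α γ : Comp} {T : Comp.diagram α → ℕ}
    (hT : IsTableau (· < ·) (· ≤ ·) T) (hc : content T = Comp.expo γ)
    (h : entrySum (Comp.expo γ) ≤ entrySum (Comp.expo α)) : T = fun c => c.1.1 := by
  rw [← hc, ← content_row, entrySum_content, entrySum_content] at h
  have := (Finset.sum_eq_sum_iff_of_le fun c _ => row_le_of_isTableau hT c).1
    (h.antisymm' (Finset.sum_le_sum fun c _ => row_le_of_isTableau hT c))
  exact funext fun c => (this c (Finset.mem_univ c)).symm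

theorem pairing_nchComp_dualImmaculate_self (α : Comp) :
    pairing (nchComp α) (dualImmaculate α) = 1 := by
  rw [pairing_nchComp_family isTableauFamily_dualImmaculate, Nat.cast_eq_one]
  refine Nat.card_eq_one_iff_unique.2 ⟨⟨fun S T => Subtype.ext (Subtype.ext ?_)⟩,
    ⟨⟨⟨_, isTableau_row α⟩, content_row α⟩⟩⟩
  rw [eq_row_of_content S.1.2 S.2 le_rfl, eq_row_of_content T.1.2 T.2 le_rfl]

theorem pairing_nchComp_dualImmaculate_eq_zero {α γ : Comp} (hne : α ≠ γ)
    (h : entrySum (Comp.expo γ) ≤ entrySum (Comp.expo α)) :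
    pairing (nchComp γ) (dualImmaculate α) = 0 := by
  rw [pairing_nchComp_family isTableauFamily_dualImmaculate, Nat.cast_eq_zero]
  have : IsEmpty (TableauOfContent (· < ·) (· ≤ ·) (Comp.diagram α) (Comp.expo γ)) := by
    refine ⟨fun T => hne (Comp.expo_injective ?_)⟩
    rw [← content_row, ← eq_row_of_content T.1.2 T.2 h, T.2]
  exact Nat.card_of_isEmpty

theorem card_diagram (α : Comp) : (Comp.diagram α).card = Comp.size α := by
  rw [← degree_content fun c : Comp.diagram α => c.1.1, content_row]
  exact degree_exponent α _

/-- A tableau of shape `α` and content `γ` exists only if `|α| = |γ|`. -/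
theorem finite_pairing_ne_zero {P Q : ℕ → ℕ → Prop} {f : Comp → QSym} (hf : IsTableauFamily P Q f)
    (γ : Comp) : {α : Comp | pairing (nchComp γ) (f α) ≠ 0}.Finite := by
  refine (finite_size_le (Comp.size γ)).subset fun α hα => ?_
  rw [Set.mem_ofPred_eq, pairing_nchComp_family hf, Nat.cast_ne_zero, tableauCount,
    Nat.card_ne_zero] at hα
  obtain ⟨T⟩ := hα.1
  rw [Set.mem_ofPred_eq, ← card_diagram, ← degree_content T.1.1, T.2]
  exact (degree_exponent γ _).le

theorem exists_isDualElement_dualImmaculate (β : Comp) :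
    ∃ g, IsDualElement dualImmaculate β g := by
  classical
  -- Inversion of a unitriangular matrix by induction on the entry sum: every other `α` with `⟨h_β,
  -- 𝔖*_α⟩ ≠ 0` has a smaller sum than `β`, so its dual element `t α` is available for subtraction
  -- from `h_β`.
  suffices ∀ n, ∀ β, entrySum (Comp.expo β) = n → ∃ g, IsDualElement dualImmaculate β g from
    this _ β rfl
  intro n
  induction n using Nat.strong_induction_on with
  | _ n ih =>
    rintro β rfl
    let K : Comp → ℚ := fun α => pairing (nchComp β) (dualImmaculate α)
    have hfin : {α | K α ≠ 0}.Finite := finite_pairing_ne_zero isTableauFamily_dualImmaculate β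
    have hlt : ∀ α, α ∈ hfin.toFinset.erase β → ∃ g, IsDualElement dualImmaculate α g := by
      intro α hα
      rw [Finset.mem_erase, Set.Finite.mem_toFinset] at hα
      refine ih _ ?_ α rfl
      by_contra! hle
      exact hα.2 (pairing_nchComp_dualImmaculate_eq_zero hα.1 hle)
    choose! t ht using hlt
    refine ⟨nchComp β - ∑ α ∈ hfin.toFinset.erase β, K α • t α, fun α => ?_⟩
    have h1 : ∀ α' ∈ hfin.toFinset.erase β, K α' • pairing (t α') (dualImmaculate α) =
        if α' = α then K α else 0 := by
      intro α' hα'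
      rw [ht α' hα' α]
      split_ifs with h
      · rw [h, smul_eq_mul, mul_one]
      · rw [smul_zero]
    simp only [map_sub, map_sum, map_smul, LinearMap.sub_apply, LinearMap.sum_apply,
      LinearMap.smul_apply]
    rw [Finset.sum_congr rfl h1, Finset.sum_ite_eq']
    rcases eq_or_ne β α with rfl | hne
    · simp [pairing_nchComp_dualImmaculate_self]
    · rw [if_neg hne]
      split_ifs with h
      · exact sub_self _
      · rw [Finset.mem_erase, Set.Finite.mem_toFinset, Set.mem_ofPred_eq] at h
        rw [sub_zero]
        by_contra h0
        exact h ⟨hne.symm, h0⟩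

theorem eq_zero_of_pairing_dualImmaculate {g : NSym}
    (h : ∀ α, pairing g (dualImmaculate α) = 0) : g = 0 := by
  by_contra hg
  have hne : (nchBasis.repr g).support.Nonempty := by
    rwa [Finsupp.support_nonempty_iff, ne_eq, LinearEquiv.map_eq_zero_iff]
  -- For `γ` of maximal entry sum in the support of `g`, triangularity kills every other term of
  -- `⟨g, 𝔖*_γ⟩`, which is therefore the coefficient of `h_γ` in `g`.
  obtain ⟨γ, hγ, hmax⟩ := Finset.exists_max_image _ (fun γ => entrySum (Comp.expo γ)) hne
  refine Finsupp.mem_support_iff.1 hγ ?_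
  rw [← h γ]
  conv_rhs => rw [← nchBasis.linearCombination_repr g, Finsupp.linearCombination_apply, Finsupp.sum]
  simp only [map_sum, map_smul, LinearMap.sum_apply, LinearMap.smul_apply, nchBasis_apply]
  rw [Finset.sum_eq_single γ]
  · rw [pairing_nchComp_dualImmaculate_self, smul_eq_mul, mul_one]
  · intro δ hδ hne
    rw [pairing_nchComp_dualImmaculate_eq_zero hne.symm (hmax δ hδ), smul_zero]
  · exact fun h => (h hγ).elim

theorem existsUnique_isDualElement_dualImmaculate (β : Comp) :
    ∃! g, IsDualElement dualImmaculate β g := by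
  obtain ⟨g, hg⟩ := exists_isDualElement_dualImmaculate β
  refine ⟨g, hg, fun g' hg' => sub_eq_zero.1 (eq_zero_of_pairing_dualImmaculate fun α => ?_)⟩
  rw [map_sub, LinearMap.sub_apply, hg, hg', sub_self]

/-! ### The involution that exchanges the two families -/

section Toggle

variable {α δ : Comp}

/-- `ε` lies between `δ` and `α`, with at most one cell of `ε/δ` in the first column and at most one
cell of `α/ε` in every row. -/
structure IsIntermediate (α δ ε : Comp) : Prop where
  left : Comp.diagram δ ⊆ Comp.diagram ε
  right : Comp.diagram ε ⊆ Comp.diagram α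
  column : AtMostOneInFirstColumn (Comp.skewDiagram ε δ)
  row : AtMostOneInRow (Comp.skewDiagram α ε)

theorem mem_skewDiagram {α β : Comp} {c : ℕ × ℕ} :
    c ∈ Comp.skewDiagram α β ↔ c ∈ Comp.diagram α ∧ c ∉ Comp.diagram β := Finset.mem_sdiff

/-- `(i, j)` is the last cell of `α` in the lowest row in which `α` and `δ` differ. -/
structure IsLastInLowestRow (α δ : Comp) (i j : ℕ) : Prop where
  mem : (i, j) ∈ Comp.skewDiagram α δ
  lowest : ∀ i' j', (i', j') ∈ Comp.skewDiagram α δ → i ≤ i'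
  last : ∀ j', (i, j') ∈ Comp.diagram α → j' ≤ j

theorem exists_isLastInLowestRow (h : (Comp.skewDiagram α δ).Nonempty) :
    ∃ i j, IsLastInLowestRow α δ i j := by
  classical
  obtain ⟨⟨i, j₀⟩, h₀, hmin⟩ := Finset.exists_min_image _ Prod.fst h
  obtain ⟨⟨i', j⟩, hj, hmax⟩ := Finset.exists_max_image
    ((Comp.diagram α).filter fun c => c.1 = i) Prod.snd
    ⟨(i, j₀), Finset.mem_filter.2 ⟨(mem_skewDiagram.1 h₀).1, rfl⟩⟩
  simp only [Finset.mem_filter] at hj hmax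
  obtain ⟨hj, rfl⟩ := hj
  have hlast : ∀ j', (i', j') ∈ Comp.diagram α → j' ≤ j := fun j' h' => hmax (i', j') ⟨h', rfl⟩
  rw [mem_skewDiagram] at h₀
  exact ⟨i', j, mem_skewDiagram.2 ⟨hj, fun h' => h₀.2 (Comp.mem_diagram_of_le h' (hlast _ h₀.1))⟩,
    fun a b hab => hmin (a, b) hab, hlast⟩

variable {ε : Comp} {i j : ℕ}

/-- Removing the last cell of its row in `α` leaves no gap in the row, and the whole row lay in `ε`,
so only this cell of the row becomes free. If it is in the first column, a cell of `ε` above it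
there would be a second cell of `ε/δ` in that column. -/
theorem IsIntermediate.erase (hc : IsLastInLowestRow α δ i j) (hε : IsIntermediate α δ ε)
    (hmem : (i, j) ∈ Comp.diagram ε) :
    ∃ ε', IsIntermediate α δ ε' ∧ Comp.diagram ε' = (Comp.diagram ε).erase (i, j) := by
  have hcδ := (mem_skewDiagram.1 hc.mem).2
  obtain ⟨ε', h'⟩ := Comp.exists_diagram_eq ((Comp.diagram ε).erase (i, j)) (by
    intro a b hab b' hb
    rw [Finset.mem_erase] at hab ⊢
    refine ⟨?_, Comp.mem_diagram_of_le hab.2 hb⟩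
    rintro ⟨⟩
    have := hc.last _ (hε.right hab.2)
    exact hab.1 (by rw [le_antisymm this hb])) (by
    intro a ha a' haa
    rw [Finset.mem_erase] at ha ⊢
    have ha' := Comp.mem_diagram_zero.2 (haa.trans_lt (Comp.mem_diagram_zero.1 ha.2))
    refine ⟨?_, ha'⟩
    rintro ⟨⟩
    refine ha.1 ?_
    have haδ : (a, 0) ∉ Comp.diagram δ := fun h =>
      hcδ (Comp.mem_diagram_zero.2 (haa.trans_lt (Comp.mem_diagram_zero.1 h)))
    rw [hε.column a i (mem_skewDiagram.2 ⟨ha.2, haδ⟩) (mem_skewDiagram.2 ⟨hmem, hcδ⟩)])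
  refine ⟨ε', ⟨?_, ?_, ?_, ?_⟩, h'⟩
  · rw [h']
    exact Finset.subset_erase.2 ⟨hε.left, hcδ⟩
  · rw [h']
    exact (Finset.erase_subset _ _).trans hε.right
  · intro a a' ha ha'
    rw [mem_skewDiagram, h', Finset.mem_erase] at ha ha'
    exact hε.column a a' (mem_skewDiagram.2 ⟨ha.1.2, ha.2⟩) (mem_skewDiagram.2 ⟨ha'.1.2, ha'.2⟩)
  · have aux : ∀ b b', (i, b) ∈ Comp.diagram α → (i, b) ∉ Comp.diagram ε → (i, b') = (i, j) →
        b = b' := by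
      rintro b b' hb hb' ⟨⟩
      exact (hb' (Comp.mem_diagram_of_le hmem (hc.last b hb))).elim
    intro a b b' hb hb'
    rw [mem_skewDiagram, h', Finset.mem_erase, not_and_or, not_not] at hb hb'
    obtain ⟨hb, hb1 | hb1⟩ := hb <;> obtain ⟨hb', hb2 | hb2⟩ := hb'
    · cases hb1
      cases hb2
      rfl
    · obtain rfl : a = i := congrArg Prod.fst hb1
      exact (aux _ _ hb' hb2 hb1).symm
    · obtain rfl : a = i := congrArg Prod.fst hb2
      exact aux _ _ hb hb1 hb2
    · exact hε.row a b b' (mem_skewDiagram.2 ⟨hb, hb1⟩) (mem_skewDiagram.2 ⟨hb', hb2⟩)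

/-- The row of `α/ε` has no other cell, so all cells to the left are already in `ε`. In the first
column, the cells below lie in `δ` because the row is the lowest one where `α` and `δ` differ, and
no cell above lies in `ε`; hence `ε/δ` had no cell in that column. -/
theorem IsIntermediate.insert (hc : IsLastInLowestRow α δ i j) (hε : IsIntermediate α δ ε)
    (hmem : (i, j) ∉ Comp.diagram ε) :
    ∃ ε', IsIntermediate α δ ε' ∧ Comp.diagram ε' = insert (i, j) (Comp.diagram ε) := by
  have hcα := (mem_skewDiagram.1 hc.mem).1
  obtain ⟨ε', h'⟩ := Comp.exists_diagram_eq (Insert.insert (i, j) (Comp.diagram ε)) (by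
    intro a b hab b' hb
    rw [Finset.mem_insert] at hab ⊢
    rcases hab with ⟨⟨⟩⟩ | hab
    · by_contra! h
      exact h.1 (by rw [hε.row i b' j (mem_skewDiagram.2 ⟨Comp.mem_diagram_of_le hcα hb, h.2⟩)
        (mem_skewDiagram.2 ⟨hcα, hmem⟩)])
    · exact Or.inr (Comp.mem_diagram_of_le hab hb)) (by
    intro a ha a' haa
    rw [Finset.mem_insert] at ha ⊢
    rcases ha with ⟨⟨⟩⟩ | ha
    · rcases haa.lt_or_eq with hlt | rfl
      · refine Or.inr (hε.left ?_)
        by_contra hδ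
        have := hc.lowest a' 0 (mem_skewDiagram.2
          ⟨Comp.mem_diagram_zero.2 (haa.trans_lt (Comp.mem_diagram_zero.1 hcα)), hδ⟩)
        omega
      · exact Or.inl rfl
    · exact Or.inr (Comp.mem_diagram_zero.2 (haa.trans_lt (Comp.mem_diagram_zero.1 ha))))
  refine ⟨ε', ⟨?_, ?_, ?_, ?_⟩, h'⟩
  · rw [h']
    exact hε.left.trans (Finset.subset_insert _ _)
  · rw [h']
    exact Finset.insert_subset hcα hε.right
  · have aux : ∀ a a', (a, 0) = (i, j) → (a', 0) ∈ Comp.diagram ε → (a', 0) ∉ Comp.diagram δ →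
        a = a' := by
      rintro a a' ⟨⟩ ha ha'
      have h1 := hc.lowest a' 0 (mem_skewDiagram.2 ⟨hε.right ha, ha'⟩)
      exact (hmem (Comp.mem_diagram_zero.2 (h1.trans_lt (Comp.mem_diagram_zero.1 ha)))).elim
    intro a a' ha ha'
    rw [mem_skewDiagram, h', Finset.mem_insert] at ha ha'
    obtain ⟨ha1 | ha1, ha2⟩ := ha <;> obtain ⟨hb1 | hb1, hb2⟩ := ha'
    · cases ha1
      cases hb1
      rfl
    · exact aux _ _ ha1 hb1 hb2
    · exact (aux _ _ hb1 ha1 ha2).symm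
    · exact hε.column a a' (mem_skewDiagram.2 ⟨ha1, ha2⟩) (mem_skewDiagram.2 ⟨hb1, hb2⟩)
  · intro a b b' hb hb'
    rw [mem_skewDiagram, h', Finset.mem_insert, not_or] at hb hb'
    exact hε.row a b b' (mem_skewDiagram.2 ⟨hb.1, hb.2.2⟩) (mem_skewDiagram.2 ⟨hb'.1, hb'.2.2⟩)

/-- Toggling the cell `(i, j)`, which depends only on `α` and `δ`, is a fixed-point-free involution
on the intermediate shapes that changes `|ε/δ|` by one. -/
theorem sum_isIntermediate_eq_zero (h : (Comp.skewDiagram α δ).Nonempty)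
    [DecidablePred (IsIntermediate α δ)] :
    ∑ ε ∈ (Comp.subs α).filter (IsIntermediate α δ), (-1 : ℚ) ^ (Comp.skewDiagram ε δ).card = 0 := by
  classical
  obtain ⟨i, j, hc⟩ := exists_isLastInLowestRow h
  have hcδ := (mem_skewDiagram.1 hc.mem).2
  have htoggle : ∀ ε, IsIntermediate α δ ε → ∃ ε', IsIntermediate α δ ε' ∧
      Comp.diagram ε' = if (i, j) ∈ Comp.diagram ε then (Comp.diagram ε).erase (i, j)
        else Insert.insert (i, j) (Comp.diagram ε) := by
    intro ε hε
    split_ifs with hmem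
    · exact hε.erase hc hmem
    · exact hε.insert hc hmem
  choose! t ht ht' using htoggle
  have hcard : ∀ ε, (i, j) ∈ Comp.diagram ε →
      (Comp.skewDiagram ε δ).card = ((Comp.diagram ε).erase (i, j) \ Comp.diagram δ).card + 1 := by
    intro ε hmem
    rw [Finset.erase_sdiff_comm, Finset.card_erase_add_one (Finset.mem_sdiff.2 ⟨hmem, hcδ⟩)]
    rfl
  refine Finset.sum_involution (fun ε _ => t ε) ?_ ?_ ?_ ?_
  · intro ε hε
    have hε := (Finset.mem_filter.1 hε).2
    have h1 := ht' ε hε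
    by_cases hmem : (i, j) ∈ Comp.diagram ε
    · rw [if_pos hmem] at h1
      rw [hcard ε hmem, Comp.skewDiagram, h1]
      ring
    · rw [if_neg hmem] at h1
      rw [hcard (t ε) (by rw [h1]; exact Finset.mem_insert_self _ _), h1,
        Finset.erase_insert hmem, Comp.skewDiagram]
      ring
  · intro ε hε _ heq
    have h1 := ht' ε (Finset.mem_filter.1 hε).2
    rw [heq] at h1
    by_cases hmem : (i, j) ∈ Comp.diagram ε
    · rw [if_pos hmem] at h1
      rw [h1] at hmem
      exact Finset.notMem_erase _ _ hmem
    · rw [if_neg hmem] at h1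
      rw [h1] at hmem
      exact hmem (Finset.mem_insert_self _ _)
  · intro ε hε
    have h1 := ht ε (Finset.mem_filter.1 hε).2
    exact Finset.mem_filter.2 ⟨Comp.mem_subs.2 h1.right, h1⟩
  · intro ε hε
    have hε := (Finset.mem_filter.1 hε).2
    apply Comp.diagram_injective
    rw [ht' _ (ht ε hε), ht' ε hε]
    by_cases hmem : (i, j) ∈ Comp.diagram ε
    · rw [if_pos hmem, if_neg (Finset.notMem_erase _ _), Finset.insert_erase hmem]
    · rw [if_neg hmem, if_pos (Finset.mem_insert_self _ _), Finset.erase_insert hmem]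

end Toggle

/-! ### Pieri rules for the two families and their comparison under `nsymPsi` -/

section Duality

open scoped Classical in
/-- The indicator of the skew shapes with `m` cells and property `R`. -/
noncomputable def stripIndicator (R : Finset (ℕ × ℕ) → Prop) (m : ℕ) (α δ : Comp) : ℚ :=
  if (Comp.skewDiagram α δ).card = m ∧ R (Comp.skewDiagram α δ) then 1 else 0

theorem pairing_mul_nch_dualImmaculate (g : NSym) (m : ℕ) (α : Comp) :
    pairing (g * nch m) (dualImmaculate α) = ∑ δ ∈ Comp.subs α,
      stripIndicator AtMostOneInFirstColumn m α δ * pairing g (dualImmaculate δ) := by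
  classical
  exact pairing_mul_nch isShiftOrder_lt isShiftOrder_le isTableauFamily_dualImmaculate
    isTableau_lt_le_zero g m α

theorem pairing_mul_nch_rowStrictDualImmaculate (g : NSym) (m : ℕ) (α : Comp) :
    pairing (g * nch m) (rowStrictDualImmaculate α) = ∑ δ ∈ Comp.subs α,
      stripIndicator AtMostOneInRow m α δ * pairing g (rowStrictDualImmaculate δ) := by
  classical
  exact pairing_mul_nch isShiftOrder_le isShiftOrder_lt isTableauFamily_rowStrictDualImmaculate
    isTableau_le_lt_zero g m α

theorem sum_stripIndicator_zero {R : Finset (ℕ × ℕ) → Prop} (hR : R ∅) (f : Comp → ℚ) (α : Comp) :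
    ∑ δ ∈ Comp.subs α, stripIndicator R 0 α δ * f δ = f α := by
  rw [Finset.sum_eq_single α]
  · rw [stripIndicator, if_pos, one_mul]
    simp [Comp.skewDiagram, hR]
  · intro δ hδ hne
    rw [stripIndicator, if_neg, zero_mul]
    rintro ⟨h, -⟩
    rw [Finset.card_eq_zero, Comp.skewDiagram, Finset.sdiff_eq_empty_iff_subset] at h
    exact hne (Comp.diagram_injective ((Comp.mem_subs.1 hδ).antisymm h))
  · exact fun h => (h (Comp.mem_subs.2 subset_rfl)).elim

/-- For a given `ε` the indicators allow only `p = (|ε/δ|, |α/ε|)`, which lies on the antidiagonal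
exactly when `|α/δ| = m`. -/
theorem sum_antidiagonal_stripIndicator {m : ℕ} {α δ ε : Comp}
    (hδε : Comp.diagram δ ⊆ Comp.diagram ε) (hεα : Comp.diagram ε ⊆ Comp.diagram α) [Decidable (IsIntermediate α δ ε)] :
    ∑ p ∈ Finset.HasAntidiagonal.antidiagonal m,
      (-1 : ℚ) ^ p.1 * (stripIndicator AtMostOneInRow p.2 α ε *
      stripIndicator AtMostOneInFirstColumn p.1 ε δ) =
      if (Comp.skewDiagram α δ).card = m ∧ IsIntermediate α δ ε then
        (-1 : ℚ) ^ (Comp.skewDiagram ε δ).card else 0 := by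
  have hcard : (Comp.skewDiagram α δ).card =
      (Comp.skewDiagram ε δ).card + (Comp.skewDiagram α ε).card := by
    simp only [Comp.skewDiagram, Finset.card_sdiff_of_subset, hδε, hεα, hδε.trans hεα]
    have := Finset.card_le_card hδε
    have := Finset.card_le_card hεα
    omega
  split_ifs with h
  · rw [Finset.sum_eq_single ((Comp.skewDiagram ε δ).card, (Comp.skewDiagram α ε).card)]
    · simp [stripIndicator, h.2.row, h.2.column]
    · rintro ⟨a, b⟩ _ hne
      by_cases ha : (Comp.skewDiagram ε δ).card = a
      · have hb : (Comp.skewDiagram α ε).card ≠ b := fun hb => hne (by rw [ha, hb])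
        simp [stripIndicator, hb]
      · simp [stripIndicator, ha]
    · intro h'
      rw [Finset.HasAntidiagonal.mem_antidiagonal] at h'
      exact (h' (hcard.symm.trans h.1)).elim
  · refine Finset.sum_eq_zero fun p hp => ?_
    rw [Finset.HasAntidiagonal.mem_antidiagonal] at hp
    by_contra h0
    have h1 := left_ne_zero_of_mul (right_ne_zero_of_mul h0)
    have h2 := right_ne_zero_of_mul (right_ne_zero_of_mul h0)
    simp only [stripIndicator, ne_eq, ite_eq_right_iff, one_ne_zero, imp_false, not_not] at h1 h2
    exact h ⟨by omega, hδε, hεα, h2.2, h1.2⟩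

theorem sum_subs_subs (α : Comp) (F : Comp → Comp → ℚ) :
    ∑ ε ∈ Comp.subs α, ∑ δ ∈ Comp.subs ε, F ε δ =
      ∑ δ ∈ Comp.subs α, ∑ ε ∈ (Comp.subs α).filter (fun ε => δ ∈ Comp.subs ε), F ε δ := by
  refine Finset.sum_comm' fun ε δ => ?_
  simp only [Finset.mem_filter, Comp.mem_subs]
  exact ⟨fun h => ⟨h, h.2.trans h.1⟩, fun h => h.1⟩

/-- The combinatorial counterpart of `∑ (-1)^a e_a h_b = 0`: after exchanging sums, the coefficient
of `f δ` is the signed sum over intermediate shapes, and `m > 0` makes `α/δ` nonempty. -/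
theorem sum_antidiagonal_sum_stripIndicator {m : ℕ} (hm : 0 < m) (f : Comp → ℚ) (α : Comp) :
    ∑ p ∈ Finset.HasAntidiagonal.antidiagonal m, (-1 : ℚ) ^ p.1 * ∑ ε ∈ Comp.subs α,
      stripIndicator AtMostOneInRow p.2 α ε *
        ∑ δ ∈ Comp.subs ε, stripIndicator AtMostOneInFirstColumn p.1 ε δ * f δ = 0 := by
  classical
  simp_rw [Finset.mul_sum, sum_subs_subs]
  rw [Finset.sum_comm]
  refine Finset.sum_eq_zero fun δ _ => ?_
  rw [Finset.sum_comm]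
  have key : ∀ ε ∈ (Comp.subs α).filter (fun ε => δ ∈ Comp.subs ε),
      ∑ p ∈ Finset.HasAntidiagonal.antidiagonal m, (-1 : ℚ) ^ p.1 *
        (stripIndicator AtMostOneInRow p.2 α ε * (stripIndicator AtMostOneInFirstColumn p.1 ε δ * f δ)) =
      (if (Comp.skewDiagram α δ).card = m ∧ IsIntermediate α δ ε then
        (-1 : ℚ) ^ (Comp.skewDiagram ε δ).card else 0) * f δ := by
    intro ε hε
    rw [Finset.mem_filter, Comp.mem_subs, Comp.mem_subs] at hε
    rw [← sum_antidiagonal_stripIndicator hε.2 hε.1, Finset.sum_mul]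
    exact Finset.sum_congr rfl fun p _ => by ring
  rw [Finset.sum_congr rfl key, ← Finset.sum_mul]
  by_cases h : (Comp.skewDiagram α δ).card = m
  · have hne : (Comp.skewDiagram α δ).Nonempty := Finset.card_pos.1 (h ▸ hm)
    simp only [h, true_and]
    rw [← Finset.sum_filter, Finset.filter_filter]
    convert zero_mul (f δ) using 2
    rw [← sum_isIntermediate_eq_zero hne]
    refine Finset.sum_congr (Finset.filter_congr fun ε _ => ?_) fun _ _ => rfl
    exact ⟨fun h => h.2, fun h => ⟨Comp.mem_subs.2 h.left, h⟩⟩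
  · simp [h]

/-- The coefficient of `t^m` in `E(-t) H(t) = 1`, where `E` and `H` generate the `e_n` and the
`h_n`. -/
theorem sum_antidiagonal_nce_mul_nch {m : ℕ} (hm : 0 < m) :
    ∑ p ∈ Finset.HasAntidiagonal.antidiagonal m, (-1 : NSym) ^ p.1 * nce p.1 * nch p.2 = 0 := by
  have := congrArg (PowerSeries.coeff m) (signedCompositionSum_mk_mul nce (by simp [nce]))
  rw [PowerSeries.coeff_mul, PowerSeries.coeff_one, if_neg hm.ne'] at this
  simp only [PowerSeries.coeff_mk] at this
  exact this

/-- Multiplication by `e_m` acts on the row-strict family as multiplication by `h_m` does on the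
immaculate one. -/
theorem pairing_mul_nce_rowStrictDualImmaculate (g : NSym) (m : ℕ) (α : Comp) :
    pairing (g * nce m) (rowStrictDualImmaculate α) = ∑ δ ∈ Comp.subs α,
      stripIndicator AtMostOneInFirstColumn m α δ * pairing g (rowStrictDualImmaculate δ) := by
  induction m using Nat.strong_induction_on generalizing α with
  | _ m ih =>
    rcases Nat.eq_zero_or_pos m with rfl | hm
    · rw [sum_stripIndicator_zero (by intro _ _ h; simp at h)]
      simp [nce]
    · have h1 := sum_antidiagonal_sum_stripIndicator hm
        (fun δ => pairing g (rowStrictDualImmaculate δ)) α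
      have h2 : ∑ p ∈ Finset.HasAntidiagonal.antidiagonal m, (-1 : ℚ) ^ p.1 * ∑ ε ∈ Comp.subs α,
          stripIndicator AtMostOneInRow p.2 α ε *
            pairing (g * nce p.1) (rowStrictDualImmaculate ε) = 0 := by
        have := congrArg (fun z => pairing (g * z) (rowStrictDualImmaculate α))
          (sum_antidiagonal_nce_mul_nch hm)
        simp only [mul_zero, map_zero, LinearMap.zero_apply, Finset.mul_sum, map_sum,
          LinearMap.sum_apply] at this
        rw [← this]
        refine Finset.sum_congr rfl fun p _ => ?_
        have hs : g * ((-1 : NSym) ^ p.1 * nce p.1 * nch p.2) =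
            (-1 : ℚ) ^ p.1 • (g * nce p.1 * nch p.2) := by
          rcases neg_one_pow_eq_or ℚ p.1 with h | h <;>
          rcases Nat.even_or_odd p.1 with h' | h' <;>
          simp [h'.neg_one_pow, mul_assoc]
        rw [hs, map_smul, LinearMap.smul_apply, pairing_mul_nch_rowStrictDualImmaculate, smul_eq_mul]
      -- The true action of the `e_a` and the expected one satisfy the same recursion. By induction
      -- the terms with `a < m` agree; in the term `(m, 0)` the row indicator forces `ε = α`,
      -- leaving the claim up to sign.
      have h3 := h2.trans h1.symm
      rw [← sub_eq_zero, ← Finset.sum_sub_distrib, Finset.sum_eq_single (m, 0)] at h3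
      · simp only [sum_stripIndicator_zero (R := AtMostOneInRow) (by intro _ _ _ h; simp at h)] at h3
        rw [← mul_sub] at h3
        exact sub_eq_zero.1 ((mul_eq_zero.1 h3).resolve_left (pow_ne_zero _ (by norm_num)))
      · rintro ⟨a, b⟩ hab hne
        rw [Finset.HasAntidiagonal.mem_antidiagonal] at hab
        simp only at hab
        have ha : a < m := by
          refine lt_of_le_of_ne (by omega) fun h => hne ?_
          rw [Prod.mk.injEq]
          omega
        rw [sub_eq_zero]
        simp only [ih a ha]
      · exact fun h => (h (Finset.HasAntidiagonal.mem_antidiagonal.2 rfl)).elim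

theorem pairing_one_family {P Q : ℕ → ℕ → Prop} {f : Comp → QSym} (hf : IsTableauFamily P Q f)
    (α : Comp) : pairing 1 (f α) = if α = [] then 1 else 0 := by
  classical
  have h1 : (1 : NSym) = nchComp [] := by simp [nchComp]
  have h2 : Comp.expo [] = Finsupp.single 0 0 := by
    ext n
    simp [Comp.expo_apply, Comp.part]
  rw [h1, pairing_nchComp_family hf, h2, tableauCount_single]
  have h3 : (Comp.diagram α).card = 0 ↔ α = [] := by
    rw [Finset.card_eq_zero, show (∅ : Finset (ℕ × ℕ)) = Comp.diagram [] from rfl,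
      Comp.diagram_injective.eq_iff]
  by_cases h : α = []
  · subst h
    rw [if_pos rfl, if_pos, Nat.cast_one]
    refine ⟨rfl, ⟨fun c => ?_, fun c => ?_⟩⟩ <;> exact absurd c.2 (by simp [Comp.diagram])
  · rw [if_neg h, if_neg, Nat.cast_zero]
    exact fun h' => h (h3.1 h'.1)

/-- Induction on `γ` from the right: `ψ` turns the last factor `h_a` into `e_a`, which strips cells
off `ℛ𝔖*_α` by the same rule by which `h_a` strips them off `𝔖*_α`. -/
theorem pairing_nsymPsi (g : NSym) (α : Comp) :
    pairing (nsymPsi g) (rowStrictDualImmaculate α) = pairing g (dualImmaculate α) := by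
  have h : (pairing.flip (rowStrictDualImmaculate α)).comp nsymPsi.toLinearMap =
      pairing.flip (dualImmaculate α) := by
    refine nchBasis.ext fun γ => ?_
    simp only [LinearMap.comp_apply, LinearMap.flip_apply, nchBasis_apply, AlgHom.toLinearMap_apply]
    induction γ using List.reverseRecOn generalizing α with
    | nil =>
      have : nchComp [] = 1 := by simp [nchComp]
      rw [this, map_one, pairing_one_family isTableauFamily_dualImmaculate,
        pairing_one_family isTableauFamily_rowStrictDualImmaculate]
    | append_singleton γ a ih =>
      have : nchComp [a] = nch a := by simp [nchComp]
      rw [nchComp_append, this, map_mul, nsymPsi_nch, pairing_mul_nce_rowStrictDualImmaculate,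
        pairing_mul_nch_dualImmaculate]
      exact Finset.sum_congr rfl fun δ _ => by rw [ih]
  exact LinearMap.congr_fun h g

theorem nsymPsi_nsymPsi (g : NSym) : nsymPsi (nsymPsi g) = g := DFunLike.congr_fun nsymPsi_comp_self g

/-- `ψ` carries elements dual to the immaculate family to elements dual to the row-strict one and,
being an involution, also back. -/
theorem existsUnique_isDualElement_rowStrictDualImmaculate (β : Comp) :
    ∃! g, IsDualElement rowStrictDualImmaculate β g := by
  obtain ⟨g, hg, huniq⟩ := existsUnique_isDualElement_dualImmaculate β
  refine ⟨nsymPsi g, fun α => by rw [pairing_nsymPsi, hg], fun g' hg' => ?_⟩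
  rw [← huniq (nsymPsi g') fun α => by rw [← pairing_nsymPsi, nsymPsi_nsymPsi, hg'], nsymPsi_nsymPsi]

end Duality

/-! ### The theorem for both families -/

theorem mainTheorem6 (α β : Comp) (hβα : Comp.Contained β α) :
    (∃! g : NSym, IsDualElement dualImmaculate β g) ∧
    (∃! g : NSym, IsDualElement rowStrictDualImmaculate β g) ∧
    (skewDualImmaculate α β : MvPowerSeries ℕ ℚ) =
      generatingFunction
        (fun T : ImmaculateTableau (Comp.skewDiagram α β) => content T.1) ∧
    (skewRowStrictDualImmaculate α β : MvPowerSeries ℕ ℚ) =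
      generatingFunction
        (fun T : RowStrictImmaculateTableau (Comp.skewDiagram α β) => content T.1) := by
  have h1 := existsUnique_isDualElement_dualImmaculate β
  have h2 := existsUnique_isDualElement_rowStrictDualImmaculate β
  refine ⟨h1, h2, ?_, ?_⟩
  -- Existence is what gives the chosen `immaculate β` its defining property; likewise for
  -- `rowStrictImmaculate β` below.
  · exact finsum_pairing_mul_nchComp isShiftOrder_lt isShiftOrder_le isTableauFamily_dualImmaculate
      hβα (Classical.epsilon_spec h1.exists)
  · exact finsum_pairing_mul_nchComp isShiftOrder_le isShiftOrder_lt
      isTableauFamily_rowStrictDualImmaculate hβα (Classical.epsilon_spec h2.exists)
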